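/- **Setting.** Let $(M,g)$ be a time-oriented four-dimensional Hausdorff Lorentzian manifold with boundary, of signature $(+,-,-,-)$, with $g$ continuous up to the boundary, which is chronological: no point $p$ lies in its own chronological future $I^+(p)$, the set of points reached from $p$ by future directed piecewise $C^1$ timelike curves in $M$. Suppose that $M$ has connected interior $\tilde M$, and that $\Omega\in C^1(M)$ satisfies $\Omega>0$ on $\tilde M$ and $\Omega=0$, $\mathrm d\Omega\ne0$ on $\partial M$. Suppose further that $\partial M$ is a null hypersurface with exactly two connected components $\mathscr I^+$ and $\mathscr I^-$, with $\mathrm d\Omega(w)<0$ at $\mathscr I^+$ and $\mathrm d\Omega(w)>0$ at $\mathscr I^-$ for all future directed timelike vectors $w$. The physical metric on $\tilde M$ is $\tilde g=\Omega^{-2}g$. Suppose that $\tilde g$ is *vacuum and stationary near infinity with mass $\mathfrak m$*, in the following sense. There are $R>0$ and coordinates $(t,x^1,x^2,x^3)$ on an open subset of $\tilde M$, with range $\{r=|x|>R\}$, in which $\tilde g$ is smooth, Ricci flat and independent of $t$, with $\partial_t$ timelike and future directed, and $$\tilde g=\Big(1-\tfrac{2\mathfrak m}{r}+\tfrac{2\mathfrak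 m^2}{r^2}+\tfrac{F}{r^3}\Big)\mathrm dt^2+\Big(\tfrac{4\epsilon_{ijk}S^jx^k}{r^3}+\tfrac{F_i}{r^3}\Big)\mathrm dt\,\mathrm dx^i-\Big(\delta_{ij}\big(1+\tfrac{2\mathfrak m}{r}+\tfrac{3\mathfrak m^2}{2r^2}\big)+\tfrac{F_{ij}}{r^3}\Big)\mathrm dx^i\mathrm dx^j$$ with constants $S^j$ and bounded functions $F,F_i,F_{ij}$. Suppose finally that null infinity is attached to this end in the usual way. That is, let $r_*$ be a continuous, strictly increasing function of $r>R$ such that $r_*-r-2\mathfrak m\log r$ converges as $r\to\infty$, and put $u=t-r_*$, $v=t+r_*$, $T=\arctan v+\arctan u$, $\chi=\arctan v-\arctan u$, $\omega=x/|x|\in S^2$. Then the parametrization of the end by $(T,\chi,\omega)$ extends to a homeomorphism from the set of all $(T,\chi,\omega)$ that are values of these coordinates on the end, or satisfy $0<\chi<\pi$, $|T|=\pi-\chi$, $\omega\in S^2$, onto an open subset of $M$; it maps the points with $T=\pi-\chi$ into $\mathscr I^+$ and those with $T=\chi-\pi$ into $\mathscr I^-$. Spatial infinity $i^0$ is the missing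 point $\chi=\pi$, $T=0$. **Claim.** If $\mathfrak m<0$, then $(M,g)$ does not have the Penrose property, i.e. it is not true that $q\in I^+(p)$ for all $p\in\mathscr I^-$ and $q\in\mathscr I^+$. More precisely, such pairs exist arbitrarily close to $i^0$: for every $\varepsilon>0$ there are points $p'\in\mathscr I^-$ and $q^*\in\mathscr I^+$ with coordinates satisfying $\chi>\pi-\varepsilon$, $|T|<\varepsilon$, such that $q^*\notin I^+(p')$. -/

import Mathlib

open Set Filter Topology
open scoped Manifold ContDiff Matrix

namespace Penrose

noncomputable section

/-- Euclidean three-space; a point of `ℝ × E3` is `(t, x)`. -/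
abbrev E3 := EuclideanSpace ℝ (Fin 3)

/-! ### Curvature of a metric given by its components in a chart with values in `ℝ × E3` -/

/-- The coordinate vectors `∂_t, ∂_1, ∂_2, ∂_3` of `ℝ × E3`. -/
def coordVec : Fin 4 → ℝ × E3 :=
  Fin.cons (1, 0) (fun i => (0, EuclideanSpace.single i 1))

/-- The partial derivative `∂_μ f`. -/
def partialD (μ : Fin 4) (f : ℝ × E3 → ℝ) (X : ℝ × E3) : ℝ :=
  fderiv ℝ f X (coordVec μ)

/-- The Christoffel symbols `Γ^l_{μν}` of the metric with components `G`. -/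
def christoffel (G : ℝ × E3 → Matrix (Fin 4) (Fin 4) ℝ) (l μ ν : Fin 4) (X : ℝ × E3) : ℝ :=
  (1 / 2) * ∑ σ, (G X)⁻¹ l σ *
    (partialD μ (fun Y => G Y σ ν) X + partialD ν (fun Y => G Y σ μ) X
      - partialD σ (fun Y => G Y μ ν) X)

/-- The components `R_{μν}` of the Ricci tensor of the metric with components `G`. -/
def ricci (G : ℝ × E3 → Matrix (Fin 4) (Fin 4) ℝ) (μ ν : Fin 4) (X : ℝ × E3) : ℝ :=
  ∑ l, (partialD l (christoffel G l μ ν) X - partialD ν (christoffel G l μ l) X)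
    + ∑ l, ∑ σ, (christoffel G l l σ X * christoffel G σ μ ν X
      - christoffel G l ν σ X * christoffel G σ μ l X)

/-! ### Spacetimes with boundary and their chronology -/

section Spacetime

variable (M : Type*) [TopologicalSpace M] [ChartedSpace (EuclideanHalfSpace 4) M]
  [IsManifold (𝓡∂ 4) 1 M]

/-- A time-oriented four-dimensional spacetime with boundary, of signature `(+,-,-,-)`.  Only
continuity of the metric (up to and including the boundary) is asked for here. -/
structure Spacetime where
  /-- the metric -/
  g : ∀ p : M, TangentSpace (𝓡∂ 4) p →L[ℝ] TangentSpace (𝓡∂ 4) p →L[ℝ] ℝ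
  symm : ∀ (p : M) (v w : TangentSpace (𝓡∂ 4) p), g p v w = g p w v
  lorentzian : ∀ p : M, ∃ e : Module.Basis (Fin 4) ℝ (TangentSpace (𝓡∂ 4) p),
    ∀ i j, g p (e i) (e j) = if i = j then (if i = 0 then 1 else -1) else 0
  continuous_g : Continuous (fun p : M =>
    Bundle.TotalSpace.mk' (EuclideanSpace ℝ (Fin 4) →L[ℝ] EuclideanSpace ℝ (Fin 4) →L[ℝ] ℝ)
      (E := fun p : M => TangentSpace (𝓡∂ 4) p →L[ℝ] TangentSpace (𝓡∂ 4) p →L[ℝ] ℝ) p (g p))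
  /-- the timelike vector field giving the time orientation -/
  timeField : ∀ p : M, TangentSpace (𝓡∂ 4) p
  continuous_timeField : Continuous (fun p : M =>
    (⟨p, timeField p⟩ : TangentBundle (𝓡∂ 4) M))
  timeField_timelike : ∀ p : M, 0 < g p (timeField p) (timeField p)

namespace Spacetime

variable {M}
variable (S : Spacetime M)

/-- `v` is timelike and future directed. -/
def FutureTimelike (p : M) (v : TangentSpace (𝓡∂ 4) p) : Prop :=
  0 < S.g p v v ∧ 0 < S.g p (S.timeField p) v

/-- `γ : [a, b] → M` is a future directed timelike curve of class `C¹` (including the ends). -/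
def IsTimelikeCurve (γ : ℝ → M) (a b : ℝ) : Prop :=
  a < b ∧ ContMDiffOn 𝓘(ℝ, ℝ) (𝓡∂ 4) 1 γ (Icc a b) ∧
    ∀ s ∈ Icc a b, S.FutureTimelike (γ s)
      (mfderivWithin 𝓘(ℝ, ℝ) (𝓡∂ 4) γ (Icc a b) s (1 : ℝ))

/-- `p` and `q` are joined by a future directed `C¹` timelike curve. -/
def TimelikeJoined (p q : M) : Prop :=
  ∃ (γ : ℝ → M) (a b : ℝ), S.IsTimelikeCurve γ a b ∧ γ a = p ∧ γ b = q

/-- The chronological future `I⁺(p)`: the points that are reached from `p` by a future directed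
piecewise `C¹` timelike curve, that is, by finitely many `C¹` ones one after the other. -/
def chronFuture (p : M) : Set M := {q | Relation.TransGen S.TimelikeJoined p q}

end Spacetime

variable {M} in
/-- The differential of a real function on `M`, as a real number: `df_p(v)`. -/
def differential (f : M → ℝ) (p : M) (v : TangentSpace (𝓡∂ 4) p) : ℝ :=
  mfderiv (𝓡∂ 4) 𝓘(ℝ, ℝ) f p v

/-- A conformal completion `(M, g)` of the physical spacetime
`(interior of M, Ω⁻² g)`, with null infinity `∂M = scriPlus ∪ scriMinus`. -/
structure ConformalCompletion extends Spacetime M where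
  /-- the conformal factor -/
  Ω : M → ℝ
  contMDiff_Ω : ContMDiff (𝓡∂ 4) 𝓘(ℝ, ℝ) 1 Ω
  Ω_pos : ∀ p ∈ (𝓡∂ 4).interior M, 0 < Ω p
  Ω_zero : ∀ p ∈ (𝓡∂ 4).boundary M, Ω p = 0
  dΩ_ne_zero : ∀ p ∈ (𝓡∂ 4).boundary M, ∃ v : TangentSpace (𝓡∂ 4) p, differential Ω p v ≠ 0
  connected : IsConnected ((𝓡∂ 4).interior M)
  /-- there are no closed timelike curves -/
  chronological : ∀ p : M, p ∉ toSpacetime.chronFuture p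
  /-- future null infinity -/
  scriPlus : Set M
  /-- past null infinity -/
  scriMinus : Set M
  boundary_eq : (𝓡∂ 4).boundary M = scriPlus ∪ scriMinus
  disjoint_scri : Disjoint scriPlus scriMinus
  scriPlus_nonempty : scriPlus.Nonempty
  scriMinus_nonempty : scriMinus.Nonempty
  component_scriPlus : ∀ p ∈ scriPlus, connectedComponentIn ((𝓡∂ 4).boundary M) p = scriPlus
  component_scriMinus : ∀ p ∈ scriMinus, connectedComponentIn ((𝓡∂ 4).boundary M) p = scriMinus
  /-- the boundary is a null hypersurface: its tangent space `ker dΩ` contains a nonzero vector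
  that is orthogonal to all of it -/
  null_boundary : ∀ p ∈ (𝓡∂ 4).boundary M, ∃ n : TangentSpace (𝓡∂ 4) p, n ≠ 0 ∧
    differential Ω p n = 0 ∧
    ∀ w : TangentSpace (𝓡∂ 4) p, differential Ω p w = 0 → g p n w = 0
  /-- future directed timelike vectors leave `M` at `scriPlus` ... -/
  future_scriPlus : ∀ p ∈ scriPlus, ∀ v : TangentSpace (𝓡∂ 4) p,
    toSpacetime.FutureTimelike p v → differential Ω p v < 0
  /-- ... and enter `M` at `scriMinus` -/
  past_scriMinus : ∀ p ∈ scriMinus, ∀ v : TangentSpace (𝓡∂ 4) p,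
    toSpacetime.FutureTimelike p v → 0 < differential Ω p v

namespace ConformalCompletion

variable {M}
variable (C : ConformalCompletion M)

/-- The Penrose property: any point of past null infinity and any point of future null infinity
can be joined by a timelike curve. -/
def PenroseProperty : Prop :=
  ∀ p ∈ C.scriMinus, ∀ q ∈ C.scriPlus, q ∈ C.chronFuture p

/-- The physical metric `Ω⁻² g`. -/
def physMetric (p : M) (v w : TangentSpace (𝓡∂ 4) p) : ℝ := (C.Ω p ^ 2)⁻¹ * C.g p v w

/-- The physical metric, read in coordinates `(t, x)` through `E : ℝ × E3 → M`. -/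
def chartMetric (E : ℝ × E3 → M) (X : ℝ × E3) (v w : ℝ × E3) : ℝ :=
  C.physMetric (E X) (mfderiv 𝓘(ℝ, ℝ × E3) (𝓡∂ 4) E X v)
    (mfderiv 𝓘(ℝ, ℝ × E3) (𝓡∂ 4) E X w)

/-- The matrix of components of the physical metric in the coordinates `(t, x)`. -/
def chartComponents (E : ℝ × E3 → M) (X : ℝ × E3) : Matrix (Fin 4) (Fin 4) ℝ :=
  Matrix.of fun μ ν => C.chartMetric E X (coordVec μ) (coordVec ν)

end ConformalCompletion

end Spacetime

/-! ### The asymptotic end -/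

/-- The coordinate domain `{(t, x) : R < |x|}`. -/
def endDomain (R : ℝ) : Set (ℝ × E3) := {X | R < ‖X.2‖}

/-- The asymptotic expansion with mass `m` and angular momentum `J` of a metric
`k` on `{(t, x) : R < |x|}`, the higher order terms `F`, `F_i`, `F_{ij}` being bounded.
Note that `ε_{ijk} J^j x^k` is the `i`-th component of `J × x`. -/
def HasExpansion (m R : ℝ) (J : Fin 3 → ℝ) (k : ℝ × E3 → ℝ × E3 → ℝ × E3 → ℝ) : Prop :=
  ∃ (F : ℝ × E3 → ℝ) (F₁ : Fin 3 → ℝ × E3 → ℝ) (F₂ : Fin 3 → Fin 3 → ℝ × E3 → ℝ) (K : ℝ),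
    (∀ X ∈ endDomain R, |F X| ≤ K ∧ (∀ i, |F₁ i X| ≤ K) ∧ ∀ i j, |F₂ i j X| ≤ K) ∧
    ∀ X ∈ endDomain R, ∀ (τ : ℝ) (ξ : E3),
      k X (τ, ξ) (τ, ξ) =
        (1 - 2 * m / ‖X.2‖ + 2 * m ^ 2 / ‖X.2‖ ^ 2 + F X / ‖X.2‖ ^ 3) * τ ^ 2
        + ∑ i, (4 * (crossProduct J X.2.ofLp i) / ‖X.2‖ ^ 3 + F₁ i X / ‖X.2‖ ^ 3) * (τ * ξ i)
        - ∑ i, ∑ j, ((if i = j then 1 + 2 * m / ‖X.2‖ + 3 / 2 * (m ^ 2 / ‖X.2‖ ^ 2) else 0)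
            + F₂ i j X / ‖X.2‖ ^ 3) * (ξ i * ξ j)

/-- The map `(t, x) ↦ (T, χ, ω)` to compactified coordinates: with `u = t - r_*`, `v = t + r_*`,
`T = arctan v + arctan u`, `χ = arctan v - arctan u`, and `ω = x / |x|`. -/
def compactCoord (rstar : ℝ → ℝ) (X : ℝ × E3) : ℝ × ℝ × E3 :=
  (Real.arctan (X.1 + rstar ‖X.2‖) + Real.arctan (X.1 - rstar ‖X.2‖),
   Real.arctan (X.1 + rstar ‖X.2‖) - Real.arctan (X.1 - rstar ‖X.2‖),
   (‖X.2‖)⁻¹ • X.2)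

/-- Future null infinity in the coordinates `(T, χ, ω)`; the point `χ = π` is `i⁰`. -/
def modelScriPlus : Set (ℝ × ℝ × E3) :=
  {Y | Y.2.1 ∈ Ioo 0 Real.pi ∧ Y.1 = Real.pi - Y.2.1 ∧ ‖Y.2.2‖ = 1}

/-- Past null infinity in the coordinates `(T, χ, ω)`. -/
def modelScriMinus : Set (ℝ × ℝ × E3) :=
  {Y | Y.2.1 ∈ Ioo 0 Real.pi ∧ Y.1 = Y.2.1 - Real.pi ∧ ‖Y.2.2‖ = 1}

/-- The range of the coordinates `(T, χ, ω)` on the end together with null infinity. -/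
def compactDomain (R : ℝ) (rstar : ℝ → ℝ) : Set (ℝ × ℝ × E3) :=
  compactCoord rstar '' endDomain R ∪ modelScriPlus ∪ modelScriMinus

section End

variable {M : Type*} [TopologicalSpace M] [ChartedSpace (EuclideanHalfSpace 4) M]
  [IsManifold (𝓡∂ 4) 1 M]

/-- The completion is vacuum and stationary near infinity with mass `m`: the physical spacetime has
an end with coordinates `(t, x)`, `r = |x| > R`, in which the physical metric is smooth,
stationary, Ricci flat and has the asymptotic expansion with mass `m`, and null infinity is
attached to this end by means of the compactified coordinates `(T, χ, ω)`. -/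
structure StationaryVacuumEnd (C : ConformalCompletion M) (m : ℝ) where
  R : ℝ
  R_pos : 0 < R
  /-- the coordinate chart, as a map from coordinates to points -/
  chart : OpenPartialHomeomorph (ℝ × E3) M
  chart_source : chart.source = endDomain R
  chart_target : chart.target ⊆ (𝓡∂ 4).interior M
  contMDiffOn_chart : ContMDiffOn 𝓘(ℝ, ℝ × E3) (𝓡∂ 4) 1 chart chart.source
  contMDiffOn_chart_symm : ContMDiffOn (𝓡∂ 4) 𝓘(ℝ, ℝ × E3) 1 chart.symm chart.target
  smooth : ∀ μ ν, ContDiffOn ℝ ∞ (fun X => C.chartComponents chart X μ ν) (endDomain R)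
  /-- `∂_t` is a Killing field ... -/
  stationary : ∀ (t t' : ℝ) (x : E3), R < ‖x‖ →
    C.chartComponents chart (t, x) = C.chartComponents chart (t', x)
  /-- ... which is timelike and future directed -/
  future_time : ∀ X ∈ endDomain R, C.FutureTimelike (chart X)
    (mfderiv 𝓘(ℝ, ℝ × E3) (𝓡∂ 4) chart X ((1, 0) : ℝ × E3))
  vacuum : ∀ X ∈ endDomain R, ∀ μ ν, ricci (C.chartComponents chart) μ ν X = 0
  /-- the angular momentum -/
  J : Fin 3 → ℝ
  expansion : HasExpansion m R J (C.chartMetric chart)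
  /-- the tortoise coordinate `r_*` as a function of `r`; all primitives of `√(B/A)`, where
  `A = 1 - 2m/r + G m²/r²` and `B = 1 + 2m/r + m²/r²`, have the asymptotics asked for below -/
  rstar : ℝ → ℝ
  continuousOn_rstar : ContinuousOn rstar (Ioi R)
  strictMonoOn_rstar : StrictMonoOn rstar (Ioi R)
  rstar_asymptotics : ∃ c : ℝ,
    Tendsto (fun r => rstar r - (r + 2 * m * Real.log r)) atTop (𝓝 c)
  /-- the point of `M` with compactified coordinates `(T, χ, ω)` -/
  compactChart : ℝ × ℝ × E3 → M
  /-- `(T, χ, ω)` are (continuous) coordinates on an open subset of `M` -/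
  isOpenEmbedding_compactChart :
    IsOpenEmbedding ((compactDomain R rstar).domRestrict compactChart)
  compactChart_compactCoord : ∀ X ∈ endDomain R, compactChart (compactCoord rstar X) = chart X
  compactChart_scriPlus : ∀ Y ∈ modelScriPlus, compactChart Y ∈ C.scriPlus
  compactChart_scriMinus : ∀ Y ∈ modelScriMinus, compactChart Y ∈ C.scriMinus

/-- The points of `M` whose compactified coordinates `(T, χ, ω)` satisfy `χ > π - ε` and
`|T| < ε`: the punctured neighbourhoods of spatial infinity `i⁰ = {χ = π, T = 0}`. -/
def StationaryVacuumEnd.nearSpatialInfinity {C : ConformalCompletion M} {m : ℝ}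
    (e : StationaryVacuumEnd C m) (ε : ℝ) : Set M :=
  e.compactChart '' {Y | Y ∈ compactDomain e.R e.rstar ∧ Real.pi - ε < Y.2.1 ∧ |Y.1| < ε}

end End

end

end Penrose

/-! Write $m=-\mu$ with $\mu>0$. Far out, a future timelike vector $(\tau,\xi)$ satisfies $\tau\ge
f'(r)|\xi|$, where $f(r)=r-2\mu\log r+A/r$ is a tortoise coordinate (`tort`) and $A$ absorbs the
second order terms of the metric (`exists_farRegion`). Consider $\Phi=t-\cos\theta\,f(r)$, with
$\theta$ measured from an axis $w$. The gradient of $\cos\theta\,f$ has squared length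
$\cos^2\theta\,f'^2+\sin^2\theta\,(f/r)^2$, which is at most $f'^2$ as soon as $f/r\le f'$. The
logarithm gives exactly this for large $r$ when the mass is negative (`eventually_tort_div_le`);
hence $\Phi$ is nondecreasing along timelike curves in the far region (`isTimeFunction_Φ`). It
equals the advanced time $V=t+f$ in direction $-w$ and the retarded time $U=t-f$ in direction $w$. A
curve in the far region therefore cannot go from direction $-w$ at advanced time $V_1$ to direction
$w$ at retarded time $U_2<V_1$.

A curve that makes an excursion into the unknown inner region is excluded by chronology. When it
leaves the far region it passes a point $X$ with $U(X)\ge V_1-\text{const}$ (`exists_retarded_ge`),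
and before its last return it passes a point $Y$ with $V(Y)\le U_2+\text{const}$
(`exists_advanced_le`). If $V_1-U_2$ is large, $X$ precedes $Y$ on the curve, while an explicit
timelike path in the far region leads from $Y$ to $X$ (`mem_chronFuture_of_le`): a closed timelike
curve.

Since chronological futures and pasts are open, the statement for interior points passes to
antipodal points of null infinity. Those with $v=N$ and $u=-N$ approach $i^0$ as $N\to\infty$. -/

namespace Penrose

/-! ### Linear algebra of Lorentzian forms -/

/-- The symmetric bilinear form `B` has signature `(+,-,-,-)`. -/
def IsLorentzian {V : Type*} [AddCommGroup V] [Module ℝ V] (B : V →ₗ[ℝ] V →ₗ[ℝ] ℝ) : Prop :=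
  ∃ e : Module.Basis (Fin 4) ℝ V,
    ∀ i j, B (e i) (e j) = if i = j then (if i = 0 then 1 else -1) else 0

section Lorentz

variable {V : Type*} [AddCommGroup V] [Module ℝ V] {B : V →ₗ[ℝ] V →ₗ[ℝ] ℝ}

lemma IsLorentzian.exists_coordinates (hB : IsLorentzian B) :
    ∃ c : V → Fin 4 → ℝ, ∀ v w,
      B v w = c v 0 * c w 0 - (c v 1 * c w 1 + c v 2 * c w 2 + c v 3 * c w 3) := by
  obtain ⟨e, he⟩ := hB
  refine ⟨fun v => e.repr v, fun v w => ?_⟩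
  have h := LinearMap.sum_repr_mul_repr_mul (B := B) e e v w
  rw [← h, Finsupp.sum_fintype _ _ (by simp)]
  rw [Finset.sum_congr rfl (fun i _ => Finsupp.sum_fintype _ _ (by simp))]
  simp only [he]
  simp [Fin.sum_univ_four]
  ring

/-- Cauchy–Schwarz for the spatial parts, each of which is strictly dominated by its time component.
This fixes the sign of products of timelike vectors. -/
lemma abs_dot_lt_of_timelike {a b : Fin 4 → ℝ}
    (ha : 0 < a 0 * a 0 - (a 1 * a 1 + a 2 * a 2 + a 3 * a 3))
    (hb : 0 < b 0 * b 0 - (b 1 * b 1 + b 2 * b 2 + b 3 * b 3)) :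
    |a 1 * b 1 + a 2 * b 2 + a 3 * b 3| < |a 0 * b 0| := by
  rw [← sq_lt_sq]
  have h1 : (a 1 * b 1 + a 2 * b 2 + a 3 * b 3) ^ 2 ≤
      (a 1 * a 1 + a 2 * a 2 + a 3 * a 3) * (b 1 * b 1 + b 2 * b 2 + b 3 * b 3) := by
    nlinarith [sq_nonneg (a 1 * b 2 - a 2 * b 1), sq_nonneg (a 1 * b 3 - a 3 * b 1),
      sq_nonneg (a 2 * b 3 - a 3 * b 2)]
  have h2 : (a 1 * a 1 + a 2 * a 2 + a 3 * a 3) * (b 1 * b 1 + b 2 * b 2 + b 3 * b 3) <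
      (a 0 * a 0) * (b 0 * b 0) := by
    apply mul_lt_mul'' <;> nlinarith [mul_self_nonneg (a 1), mul_self_nonneg (a 2),
      mul_self_nonneg (a 3), mul_self_nonneg (b 1), mul_self_nonneg (b 2), mul_self_nonneg (b 3)]
  nlinarith

/-- Two timelike vectors are never orthogonal. -/
lemma IsLorentzian.ne_zero_of_timelike (hB : IsLorentzian B) {v w : V}
    (hv : 0 < B v v) (hw : 0 < B w w) : B v w ≠ 0 := by
  obtain ⟨c, hc⟩ := hB.exists_coordinates
  rw [hc] at hv hw ⊢
  have := abs_dot_lt_of_timelike hv hw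
  intro h
  rw [sub_eq_zero] at h
  simp [h] at this

/-- Timelike vectors in the same half of the cone have positive product. -/
lemma IsLorentzian.pos_of_timelike (hB : IsLorentzian B) {t v w : V}
    (ht : 0 < B t t) (hv : 0 < B v v) (hw : 0 < B w w) (htv : 0 < B t v) (htw : 0 < B t w) :
    0 < B v w := by
  obtain ⟨c, hc⟩ := hB.exists_coordinates
  rw [hc] at ht hv hw htv htw ⊢
  have h1 := abs_lt.1 (abs_dot_lt_of_timelike ht hv)
  have h2 := abs_lt.1 (abs_dot_lt_of_timelike ht hw)
  have h3 := abs_dot_lt_of_timelike hv hw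
  -- Here $x$ is the product of the time components and $y$ that of the spatial parts: timelike
  -- vectors with positive product have time components of the same sign.
  have key : ∀ x y : ℝ, -|x| < y → 0 < x - y → 0 < x := by
    intro x y h h'
    by_contra hx
    rw [abs_of_nonpos (not_lt.1 hx)] at h
    linarith
  have hv0 := key _ _ h1.1 htv
  have hw0 := key _ _ h2.1 htw
  have h0 : 0 < c v 0 * c w 0 := by
    have : 0 < (c t 0) ^ 2 * (c v 0 * c w 0) := by nlinarith [mul_pos hv0 hw0]
    exact pos_of_mul_pos_right this (sq_nonneg _)
  rw [abs_of_pos h0] at h3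
  linarith [(abs_lt.1 h3).2]

end Lorentz

/-! ### The cone of future timelike vectors -/

namespace Spacetime

variable {M : Type*} [TopologicalSpace M] [ChartedSpace (EuclideanHalfSpace 4) M]
  [IsManifold (𝓡∂ 4) 1 M] (S : Spacetime M)

/-- The metric at `p` as a bilinear form. -/
noncomputable def bilin (p : M) : TangentSpace (𝓡∂ 4) p →ₗ[ℝ] TangentSpace (𝓡∂ 4) p →ₗ[ℝ] ℝ :=
  LinearMap.mk₂ ℝ (fun v w => S.g p v w) (by simp) (by simp) (by simp) (by simp)

lemma isLorentzian_bilin (p : M) : IsLorentzian (S.bilin p) := S.lorentzian p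

variable {S}

lemma FutureTimelike.pos {p : M} {v w : TangentSpace (𝓡∂ 4) p}
    (hv : S.FutureTimelike p v) (hw : S.FutureTimelike p w) : 0 < S.g p v w :=
  (S.isLorentzian_bilin p).pos_of_timelike (S.timeField_timelike p) hv.1 hw.1 hv.2 hw.2

/-- Convexity of the future cone. Applied with $w=\partial_t$, it shifts the time component of a
vector. -/
lemma FutureTimelike.add_smul {p : M} {v w : TangentSpace (𝓡∂ 4) p}
    (hv : S.FutureTimelike p v) (hw : S.FutureTimelike p w) {c : ℝ} (hc : 0 ≤ c) :
    S.FutureTimelike p (v + c • w) := by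
  have h := hv.pos hw
  have h' := S.symm p w v
  constructor
  · have : S.g p (v + c • w) (v + c • w) =
        S.g p v v + 2 * c * S.g p v w + c ^ 2 * S.g p w w := by
      simp [h']; ring
    rw [this]
    have := hv.1
    have := hw.1
    positivity
  · have := hv.2
    have := hw.2
    simp only [map_add, map_smul, smul_eq_mul]
    positivity

lemma futureTimelike_or_neg {p : M} {v : TangentSpace (𝓡∂ 4) p} (hv : 0 < S.g p v v) :
    S.FutureTimelike p v ∨ S.FutureTimelike p (-v) := by
  have h : S.g p (S.timeField p) v ≠ 0 :=
    (S.isLorentzian_bilin p).ne_zero_of_timelike (S.timeField_timelike p) hv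
  rcases h.lt_or_gt with h | h
  · right; exact ⟨by simpa using hv, by simpa using h⟩
  · left; exact ⟨hv, h⟩

variable (S)

/-- The set of future directed timelike vectors is open. -/
lemma isOpen_futureTimelike :
    IsOpen {z : TangentBundle (𝓡∂ 4) M | S.FutureTimelike z.1 z.2} := by
  have key : ∀ v w : ∀ z : TangentBundle (𝓡∂ 4) M, TangentSpace (𝓡∂ 4) z.1,
      Continuous (fun z => (⟨z.1, v z⟩ : TangentBundle (𝓡∂ 4) M)) →
      Continuous (fun z => (⟨z.1, w z⟩ : TangentBundle (𝓡∂ 4) M)) →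
      Continuous (fun z : TangentBundle (𝓡∂ 4) M => S.g z.1 (v z) (w z)) := by
    intro v w hv hw
    have hb : Continuous (fun z : TangentBundle (𝓡∂ 4) M => z.1) :=
      FiberBundle.continuous_proj _ _
    have : Continuous (fun z : TangentBundle (𝓡∂ 4) M =>
        Bundle.TotalSpace.mk' ℝ (E := Bundle.Trivial M ℝ) z.1 (S.g z.1 (v z) (w z))) :=
      (S.continuous_g.comp hb).clm_bundle_apply₂ (F₁ := EuclideanSpace ℝ (Fin 4))
        (F₂ := EuclideanSpace ℝ (Fin 4)) hv hw
    rw [continuous_iff_continuousAt] at this ⊢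
    intro z
    exact ((FiberBundle.continuousAt_totalSpace _ _).1 (this z)).2
  have hb : Continuous (fun z : TangentBundle (𝓡∂ 4) M => z.1) := FiberBundle.continuous_proj _ _
  exact (isOpen_lt continuous_const
    (key (fun z => z.2) (fun z => z.2) continuous_id continuous_id)).inter
    (isOpen_lt continuous_const (key (fun z => S.timeField z.1) (fun z => z.2)
      (S.continuous_timeField.comp hb) continuous_id))

end Spacetime

end Penrose

/-! ### Timelike curves and short coordinate segments -/

namespace Penrose
namespace Spacetime

variable {M : Type*} [TopologicalSpace M] [ChartedSpace (EuclideanHalfSpace 4) M]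

lemma hasMFDerivWithinAt_comp_curve {E' : Type*} [NormedAddCommGroup E'] [NormedSpace ℝ E']
    {f : E' → M} {D : Set E'} (hf : ContMDiffOn 𝓘(ℝ, E') (𝓡∂ 4) 1 f D) {c : ℝ → E'} {v : E'}
    {I : Set ℝ} {s : ℝ} (hs : s ∈ I) (hc : HasDerivWithinAt c v I s) (hD : MapsTo c I D) :
    HasMFDerivWithinAt 𝓘(ℝ, ℝ) (𝓡∂ 4) (f ∘ c) I s
      ((mfderivWithin 𝓘(ℝ, E') (𝓡∂ 4) f D (c s)).comp
        (ContinuousLinearMap.toSpanSingleton ℝ v : ℝ →L[ℝ] E')) := by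
  refine HasMFDerivWithinAt.comp s (u := D) ?_ ?_ hD
  · exact ((hf _ (hD hs)).mdifferentiableWithinAt one_ne_zero).hasMFDerivWithinAt
  · exact hasMFDerivWithinAt_iff_hasFDerivWithinAt.2 hc.hasFDerivWithinAt

variable [IsManifold (𝓡∂ 4) 1 M] {S : Spacetime M}

/-- The image of a `C¹` curve in a normed space under a `C¹` map, as a timelike curve. -/
lemma isTimelikeCurve_comp {E' : Type*} [NormedAddCommGroup E'] [NormedSpace ℝ E']
    {f : E' → M} {D : Set E'} (hf : ContMDiffOn 𝓘(ℝ, E') (𝓡∂ 4) 1 f D) {c c' : ℝ → E'} {a b : ℝ}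
    (hab : a < b) (hc : ContDiffOn ℝ 1 c (Icc a b))
    (hc' : ∀ s ∈ Icc a b, HasDerivWithinAt c (c' s) (Icc a b) s) (hD : MapsTo c (Icc a b) D)
    (hv : ∀ s ∈ Icc a b, S.FutureTimelike (f (c s))
      (mfderivWithin 𝓘(ℝ, E') (𝓡∂ 4) f D (c s) (c' s))) :
    S.IsTimelikeCurve (f ∘ c) a b := by
  refine ⟨hab, hf.comp hc.contMDiffOn hD, fun s hs => ?_⟩
  have h := hasMFDerivWithinAt_comp_curve hf hs (hc' s hs) hD
  rw [h.mfderivWithin ((uniqueDiffOn_Icc hab s hs).uniqueMDiffWithinAt)]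
  have e : ((1 : ℝ) • c' s : E') = c' s := one_smul _ _
  have := hv s hs
  rw [← e] at this
  exact this

lemma IsTimelikeCurve.hasMFDerivWithinAt {γ : ℝ → M} {a b : ℝ} (h : S.IsTimelikeCurve γ a b)
    {s : ℝ} (hs : s ∈ Icc a b) : HasMFDerivWithinAt 𝓘(ℝ, ℝ) (𝓡∂ 4) γ (Icc a b) s
      (mfderivWithin 𝓘(ℝ, ℝ) (𝓡∂ 4) γ (Icc a b) s) :=
  ((h.2.1 s hs).mdifferentiableWithinAt one_ne_zero).hasMFDerivWithinAt

lemma IsTimelikeCurve.mono {γ : ℝ → M} {a b a' b' : ℝ} (h : S.IsTimelikeCurve γ a b)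
    (ha : a ≤ a') (hb : b' ≤ b) (hab : a' < b') : S.IsTimelikeCurve γ a' b' := by
  have hsub : Icc a' b' ⊆ Icc a b := Icc_subset_Icc ha hb
  refine ⟨hab, h.2.1.mono hsub, fun s hs => ?_⟩
  rw [((h.hasMFDerivWithinAt (hsub hs)).mono hsub).mfderivWithin
    ((uniqueDiffOn_Icc hab s hs).uniqueMDiffWithinAt)]
  exact h.2.2 s (hsub hs)

lemma IsTimelikeCurve.timelikeJoined {γ : ℝ → M} {a b a' b' : ℝ} (h : S.IsTimelikeCurve γ a b)
    (ha : a ≤ a') (hb : b' ≤ b) (hab : a' < b') : S.TimelikeJoined (γ a') (γ b') :=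
  ⟨γ, a', b', h.mono ha hb hab, rfl, rfl⟩

/-- Near `q`, short coordinate segments whose direction is close to a future directed timelike
vector at `q` are timelike. -/
lemma exists_nhds_timelikeJoined {q : M} {w : TangentSpace (𝓡∂ 4) q} (hw : S.FutureTimelike q w) :
    ∃ U ∈ 𝓝 q, ∃ W : Set (EuclideanSpace ℝ (Fin 4)),
      W ∈ 𝓝 (mfderiv (𝓡∂ 4) 𝓘(ℝ, EuclideanSpace ℝ (Fin 4)) (extChartAt (𝓡∂ 4) q) q w :
        EuclideanSpace ℝ (Fin 4)) ∧
      ∀ p ∈ U, ∀ p' ∈ U, ∀ h : ℝ, 0 < h →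
        h⁻¹ • (extChartAt (𝓡∂ 4) q p' - extChartAt (𝓡∂ 4) q p) ∈ W → S.TimelikeJoined p p' := by
  set φ := extChartAt (𝓡∂ 4) q with hφ
  set w' : EuclideanSpace ℝ (Fin 4) :=
    mfderiv (𝓡∂ 4) 𝓘(ℝ, EuclideanSpace ℝ (Fin 4)) φ q w with hw'
  have hsymm : ContMDiffOn 𝓘(ℝ, EuclideanSpace ℝ (Fin 4)) (𝓡∂ 4) 1 φ.symm φ.target :=
    contMDiffOn_extChartAt_symm q
  have huniq : UniqueMDiffOn 𝓘(ℝ, EuclideanSpace ℝ (Fin 4)) φ.target :=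
    (uniqueDiffOn_extChartAt_target q).uniqueMDiffOn
  have hq : φ q ∈ φ.target := mem_extChartAt_target q
  have hcont := hsymm.continuousOn_tangentMapWithin le_rfl huniq
  let z : EuclideanSpace ℝ (Fin 4) × EuclideanSpace ℝ (Fin 4) →
      TangentBundle 𝓘(ℝ, EuclideanSpace ℝ (Fin 4)) (EuclideanSpace ℝ (Fin 4)) :=
    fun y => ⟨y.1, y.2⟩
  have hz : Continuous z :=
    (tangentBundleModelSpaceHomeomorph 𝓘(ℝ, EuclideanSpace ℝ (Fin 4))).symm.continuous
  have hmem : S.FutureTimelike (φ.symm (φ q)) (mfderivWithin 𝓘(ℝ, EuclideanSpace ℝ (Fin 4))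
      (𝓡∂ 4) φ.symm φ.target (φ q) w') := by
    -- The base point `φ.symm (φ q)` equals `q` only propositionally, while all tangent spaces are
    -- the same model space; generalizing point and vector avoids a transport.
    have key : ∀ p : M, p = q → ∀ v : EuclideanSpace ℝ (Fin 4), v = w →
        S.FutureTimelike p (v : TangentSpace (𝓡∂ 4) p) := by
      rintro p rfl v rfl
      exact hw
    refine key _ (extChartAt_to_inv q) _ ?_
    have h1 : HasMFDerivWithinAt (𝓡∂ 4) (𝓡∂ 4) (φ.symm ∘ φ) φ.source q
        ((mfderivWithin 𝓘(ℝ, EuclideanSpace ℝ (Fin 4)) (𝓡∂ 4) φ.symm φ.target (φ q)).comp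
          (mfderiv (𝓡∂ 4) 𝓘(ℝ, EuclideanSpace ℝ (Fin 4)) φ q)) := by
      refine HasMFDerivWithinAt.comp q (u := φ.target) ?_ ?_ (fun x hx => φ.map_source hx)
      · exact ((hsymm _ hq).mdifferentiableWithinAt one_ne_zero).hasMFDerivWithinAt
      · exact (mdifferentiableAt_extChartAt (mem_chart_source _ q)).hasMFDerivAt.hasMFDerivWithinAt
    have h2 : HasMFDerivAt (𝓡∂ 4) (𝓡∂ 4) (φ.symm ∘ φ) q
        (ContinuousLinearMap.id ℝ (TangentSpace (𝓡∂ 4) q)) := by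
      refine (hasMFDerivAt_id q).congr_of_eventuallyEq ?_
      filter_upwards [extChartAt_source_mem_nhds (I := 𝓡∂ 4) q] with x hx
      exact φ.left_inv hx
    have h3 := h1.hasMFDerivAt (extChartAt_source_mem_nhds q)
    have h4 := hasMFDerivAt_unique h3 h2
    exact DFunLike.congr_fun h4 w
  have hO : ∀ᶠ y in 𝓝[φ.target ×ˢ univ] (φ q, w'), S.FutureTimelike (φ.symm y.1)
      (mfderivWithin 𝓘(ℝ, EuclideanSpace ℝ (Fin 4)) (𝓡∂ 4) φ.symm φ.target y.1 y.2) := by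
    have h1 : ContinuousWithinAt (tangentMapWithin 𝓘(ℝ, EuclideanSpace ℝ (Fin 4)) (𝓡∂ 4)
        φ.symm φ.target ∘ z) (φ.target ×ˢ univ) (φ q, w') :=
      ContinuousWithinAt.comp (hcont (z (φ q, w')) hq) hz.continuousWithinAt
        (fun y hy => hy.1)
    exact h1.eventually (S.isOpen_futureTimelike.mem_nhds hmem)
  rw [nhdsWithin_prod_eq, nhdsWithin_univ] at hO
  obtain ⟨A, hA, W, hW, hAW⟩ : ∃ A ∈ 𝓝[φ.target] (φ q), ∃ W ∈ 𝓝 w', ∀ y ∈ A, ∀ v ∈ W,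
      S.FutureTimelike (φ.symm y) (mfderivWithin 𝓘(ℝ, EuclideanSpace ℝ (Fin 4)) (𝓡∂ 4)
        φ.symm φ.target y v) := by
    obtain ⟨A, hA, W, hW, hAW⟩ := Filter.mem_prod_iff.1 hO
    refine ⟨A, hA, W, hW, fun y hy v hv => ?_⟩
    have h := hAW (Set.mk_mem_prod hy hv)
    exact h
  have hA' : A ∩ φ.target ∈ 𝓝[range (𝓡∂ 4)] (φ q) := by
    refine inter_mem ?_ (extChartAt_target_mem_nhdsWithin q)
    rwa [← nhdsWithin_extChartAt_target_eq]
  obtain ⟨ε, hε, hball⟩ := Metric.mem_nhdsWithin_iff.1 hA'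
  refine ⟨φ.source ∩ φ ⁻¹' Metric.ball (φ q) ε, inter_mem (extChartAt_source_mem_nhds q)
    ((continuousAt_extChartAt q).preimage_mem_nhds (Metric.ball_mem_nhds _ hε)), W, hW, ?_⟩
  rintro p ⟨hp, hpb⟩ p' ⟨hp', hpb'⟩ h hh hmW
  set v := h⁻¹ • (φ p' - φ p) with hv
  -- At boundary points the chart only covers a piece of a half space; since this is convex,
  -- segments between nearby points still stay in the target.
  have hconv : Convex ℝ (Metric.ball (φ q) ε ∩ range (𝓡∂ 4)) :=
    (convex_ball _ _).inter (𝓡∂ 4).convex_range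
  have hmaps : ∀ s ∈ Icc 0 h, φ p + s • v ∈ A ∩ φ.target := by
    intro s hs
    refine hball ?_
    have := hconv.add_smul_sub_mem ⟨hpb, extChartAt_target_subset_range q (φ.map_source hp)⟩
      ⟨hpb', extChartAt_target_subset_range q (φ.map_source hp')⟩ (t := s * h⁻¹)
      ⟨by have := hs.1; positivity, by
        rw [← div_eq_mul_inv, div_le_one hh]; exact hs.2⟩
    rwa [hv, smul_smul]
  refine ⟨φ.symm ∘ fun s => φ p + s • v, 0, h, ?_, ?_, ?_⟩
  · refine isTimelikeCurve_comp (c' := fun _ => v) hsymm hh (by fun_prop) ?_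
      (fun s hs => (hmaps s hs).2) ?_
    · intro s _
      have := (((hasDerivAt_id s).smul_const v).const_add (φ p)).hasDerivWithinAt (s := Icc 0 h)
      simpa using this
    · intro s hs
      exact hAW (φ p + s • v) (hmaps s hs).1 v hmW
  · simp [φ.left_inv hp]
  · have : φ p + h • v = φ p' := by
      rw [hv, smul_smul, mul_inv_cancel₀ hh.ne', one_smul, add_sub_cancel]
    simp [this, φ.left_inv hp']

end Spacetime
end Penrose

/-! ### Openness of chronological futures and pasts; timelike curves at null infinity -/

namespace Penrose
section

variable {M : Type*} [TopologicalSpace M] [ChartedSpace (EuclideanHalfSpace 4) M]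
  [IsManifold (𝓡∂ 4) 1 M]

namespace Spacetime

variable {S : Spacetime M}

lemma IsTimelikeCurve.hasDerivWithinAt_comp {γ : ℝ → M} {a b : ℝ} (h : S.IsTimelikeCurve γ a b)
    {s : ℝ} (hs : s ∈ Icc a b) {E' : Type*} [NormedAddCommGroup E'] [NormedSpace ℝ E']
    {f : M → E'} (hf : MDifferentiableAt (𝓡∂ 4) 𝓘(ℝ, E') f (γ s)) :
    HasDerivWithinAt (f ∘ γ) (mfderiv (𝓡∂ 4) 𝓘(ℝ, E') f (γ s)
      (mfderivWithin 𝓘(ℝ, ℝ) (𝓡∂ 4) γ (Icc a b) s (1 : ℝ)) : E') (Icc a b) s := by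
  have h1 := hf.hasMFDerivAt.comp_hasMFDerivWithinAt s (h.hasMFDerivWithinAt hs)
  let A : ℝ →L[ℝ] E' := (mfderiv (𝓡∂ 4) 𝓘(ℝ, E') f (γ s)).comp
    (mfderivWithin 𝓘(ℝ, ℝ) (𝓡∂ 4) γ (Icc a b) s)
  have h2 : HasFDerivWithinAt (f ∘ γ) A (Icc a b) s :=
    hasMFDerivWithinAt_iff_hasFDerivWithinAt.1 h1
  exact h2.hasDerivWithinAt

/-- The curve is cut shortly before its end and continued by a straight coordinate segment to the
perturbed endpoint. The slope of that segment is close to the final velocity, which is timelike.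
This works up to the boundary. -/
lemma TimelikeJoined.eventually_right {p q : M} (h : S.TimelikeJoined p q) :
    ∀ᶠ q' in 𝓝 q, q' ∈ S.chronFuture p := by
  obtain ⟨γ, a, b, hγ, rfl, rfl⟩ := h
  have hab := hγ.1
  have hb : b ∈ Icc a b := right_mem_Icc.2 hab.le
  obtain ⟨U, hU, W, hW, hUW⟩ := exists_nhds_timelikeJoined (hγ.2.2 b hb)
  have hd := hγ.hasDerivWithinAt_comp hb
    (mdifferentiableAt_extChartAt (I := 𝓡∂ 4) (x := γ b) (mem_chart_source _ (γ b)))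
  replace hd := hasDerivWithinAt_iff_tendsto_slope.1 hd
  have hle : 𝓝[<] b ≤ 𝓝[Icc a b \ {b}] b := by
    rw [← nhdsWithin_Ioo_eq_nhdsLT hab]
    exact nhdsWithin_mono _ fun x hx => ⟨Ioo_subset_Icc_self hx, hx.2.ne⟩
  have hγb : Tendsto γ (𝓝[<] b) (𝓝 (γ b)) :=
    (hγ.2.1.continuousOn b hb).mono_left (hle.trans (nhdsWithin_mono _ sdiff_subset))
  have hev : ∀ᶠ s in 𝓝[<] b, γ s ∈ U ∧
      slope (extChartAt (𝓡∂ 4) (γ b) ∘ γ) b s ∈ interior W ∧ s ∈ Ioo a b :=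
    (hγb.eventually hU).and
      (((hd.mono_left hle).eventually (interior_mem_nhds.2 hW)).and (Ioo_mem_nhdsLT hab))
  obtain ⟨s, hsU, hsW, hsab⟩ := hev.exists
  have hT : Tendsto (fun q' => (b - s)⁻¹ • (extChartAt (𝓡∂ 4) (γ b) q' -
      extChartAt (𝓡∂ 4) (γ b) (γ s))) (𝓝 (γ b))
      (𝓝 (slope (extChartAt (𝓡∂ 4) (γ b) ∘ γ) b s)) := by
    rw [slope_comm]
    have : ContinuousAt (fun q' => (b - s)⁻¹ • (extChartAt (𝓡∂ 4) (γ b) q' -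
      extChartAt (𝓡∂ 4) (γ b) (γ s))) (γ b) := by
      have := continuousAt_extChartAt (I := 𝓡∂ 4) (γ b)
      fun_prop
    exact this
  filter_upwards [hU, hT.eventually (isOpen_interior.mem_nhds hsW)] with q' hq' hq'W
  exact (Relation.TransGen.single (hγ.timelikeJoined le_rfl hsab.2.le hsab.1)).tail
    (hUW _ hsU _ hq' _ (sub_pos.2 hsab.2) (interior_subset hq'W))

lemma TimelikeJoined.eventually_left {p q : M} (h : S.TimelikeJoined p q) :
    ∀ᶠ p' in 𝓝 p, q ∈ S.chronFuture p' := by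
  obtain ⟨γ, a, b, hγ, rfl, rfl⟩ := h
  have hab := hγ.1
  have ha : a ∈ Icc a b := left_mem_Icc.2 hab.le
  obtain ⟨U, hU, W, hW, hUW⟩ := exists_nhds_timelikeJoined (hγ.2.2 a ha)
  have hd := hγ.hasDerivWithinAt_comp ha
    (mdifferentiableAt_extChartAt (I := 𝓡∂ 4) (x := γ a) (mem_chart_source _ (γ a)))
  replace hd := hasDerivWithinAt_iff_tendsto_slope.1 hd
  have hle : 𝓝[>] a ≤ 𝓝[Icc a b \ {a}] a := by
    rw [← nhdsWithin_Ioo_eq_nhdsGT hab]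
    exact nhdsWithin_mono _ fun x hx => ⟨Ioo_subset_Icc_self hx, hx.1.ne'⟩
  have hγa : Tendsto γ (𝓝[>] a) (𝓝 (γ a)) :=
    (hγ.2.1.continuousOn a ha).mono_left (hle.trans (nhdsWithin_mono _ sdiff_subset))
  have hev : ∀ᶠ s in 𝓝[>] a, γ s ∈ U ∧
      slope (extChartAt (𝓡∂ 4) (γ a) ∘ γ) a s ∈ interior W ∧ s ∈ Ioo a b :=
    (hγa.eventually hU).and
      (((hd.mono_left hle).eventually (interior_mem_nhds.2 hW)).and (Ioo_mem_nhdsGT hab))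
  obtain ⟨s, hsU, hsW, hsab⟩ := hev.exists
  have hT : Tendsto (fun p' => (s - a)⁻¹ • (extChartAt (𝓡∂ 4) (γ a) (γ s) -
      extChartAt (𝓡∂ 4) (γ a) p')) (𝓝 (γ a))
      (𝓝 (slope (extChartAt (𝓡∂ 4) (γ a) ∘ γ) a s)) := by
    have : ContinuousAt (fun p' => (s - a)⁻¹ • (extChartAt (𝓡∂ 4) (γ a) (γ s) -
      extChartAt (𝓡∂ 4) (γ a) p')) (γ a) := by
      have := continuousAt_extChartAt (I := 𝓡∂ 4) (γ a)
      fun_prop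
    exact this
  filter_upwards [hU, hT.eventually (isOpen_interior.mem_nhds hsW)] with p' hp' hp'W
  exact Relation.TransGen.head (hUW _ hp' _ hsU _ (sub_pos.2 hsab.1) (interior_subset hp'W))
    (Relation.TransGen.single (hγ.timelikeJoined hsab.1.le le_rfl hsab.2))

/-- The chronological future is open. -/
lemma eventually_mem_chronFuture {p q : M} (h : q ∈ S.chronFuture p) :
    ∀ᶠ q' in 𝓝 q, q' ∈ S.chronFuture p := by
  rcases Relation.TransGen.tail'_iff.1 h with ⟨z, hpz, hzq⟩
  filter_upwards [hzq.eventually_right] with q' hq'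
  exact Relation.TransGen.trans_right hpz hq'

/-- The chronological past is open. -/
lemma eventually_chronFuture_mem {p q : M} (h : q ∈ S.chronFuture p) :
    ∀ᶠ p' in 𝓝 p, q ∈ S.chronFuture p' := by
  rcases Relation.TransGen.head'_iff.1 h with ⟨z, hpz, hzq⟩
  filter_upwards [hpz.eventually_left] with p' hp'
  exact Relation.TransGen.trans_left hp' hzq

end Spacetime

namespace ConformalCompletion

variable (C : ConformalCompletion M)

lemma Ω_nonneg (p : M) : 0 ≤ C.Ω p := by
  have h : p ∈ (𝓡∂ 4).interior M ∪ (𝓡∂ 4).boundary M := by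
    rw [ModelWithCorners.interior_union_boundary_eq_univ]; trivial
  rcases h with h | h
  · exact (C.Ω_pos p h).le
  · exact (C.Ω_zero p h).ge

lemma mem_interior_iff {p : M} :
    p ∈ (𝓡∂ 4).interior M ↔ p ∉ C.scriPlus ∧ p ∉ C.scriMinus := by
  rw [← not_or, ← mem_union, ← C.boundary_eq, ← (𝓡∂ 4).compl_boundary, mem_compl_iff]

variable {C}

lemma hasDerivWithinAt_Ω {γ : ℝ → M} {a b : ℝ} (h : C.IsTimelikeCurve γ a b)
    {s : ℝ} (hs : s ∈ Icc a b) :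
    HasDerivWithinAt (C.Ω ∘ γ) (differential C.Ω (γ s)
      (mfderivWithin 𝓘(ℝ, ℝ) (𝓡∂ 4) γ (Icc a b) s (1 : ℝ))) (Icc a b) s :=
  h.hasDerivWithinAt_comp hs ((C.contMDiff_Ω _).mdifferentiableAt one_ne_zero)

/-- If `Ω` vanished at the end of the curve, its derivative from the left would be nonpositive there
because `Ω` is nonnegative, whereas future timelike vectors increase `Ω` at past null infinity. -/
lemma notMem_scriMinus_of_timelikeJoined {p q : M} (h : C.TimelikeJoined p q) :
    q ∉ C.scriMinus := by
  obtain ⟨γ, a, b, hγ, rfl, rfl⟩ := h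
  intro hq
  have hab := hγ.1
  have hb : b ∈ Icc a b := right_mem_Icc.2 hab.le
  have hpos := C.past_scriMinus _ hq _ (hγ.2.2 b hb)
  have hd := hasDerivWithinAt_Ω hγ hb
  replace hd := hasDerivWithinAt_iff_tendsto_slope.1 hd
  have hle : 𝓝[<] b ≤ 𝓝[Icc a b \ {b}] b := by
    rw [← nhdsWithin_Ioo_eq_nhdsLT hab]
    exact nhdsWithin_mono _ fun x hx => ⟨Ioo_subset_Icc_self hx, hx.2.ne⟩
  refine hpos.not_ge (le_of_tendsto (hd.mono_left hle) ?_)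
  filter_upwards [self_mem_nhdsWithin] with s hs
  have h0 : C.Ω (γ b) = 0 := C.Ω_zero _ (C.boundary_eq ▸ Or.inr hq)
  rw [slope_def_field, Function.comp, Function.comp, h0, sub_zero]
  exact div_nonpos_of_nonneg_of_nonpos (C.Ω_nonneg _) (sub_nonpos.2 (le_of_lt hs))

lemma notMem_scriPlus_of_timelikeJoined {p q : M} (h : C.TimelikeJoined p q) :
    p ∉ C.scriPlus := by
  obtain ⟨γ, a, b, hγ, rfl, rfl⟩ := h
  intro hq
  have hab := hγ.1
  have ha : a ∈ Icc a b := left_mem_Icc.2 hab.le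
  have hneg := C.future_scriPlus _ hq _ (hγ.2.2 a ha)
  have hd := hasDerivWithinAt_Ω hγ ha
  replace hd := hasDerivWithinAt_iff_tendsto_slope.1 hd
  have hle : 𝓝[>] a ≤ 𝓝[Icc a b \ {a}] a := by
    rw [← nhdsWithin_Ioo_eq_nhdsGT hab]
    exact nhdsWithin_mono _ fun x hx => ⟨Ioo_subset_Icc_self hx, hx.1.ne'⟩
  refine hneg.not_ge (ge_of_tendsto (hd.mono_left hle) ?_)
  filter_upwards [self_mem_nhdsWithin] with s hs
  have h0 : C.Ω (γ a) = 0 := C.Ω_zero _ (C.boundary_eq ▸ Or.inl hq)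
  rw [slope_def_field, Function.comp, Function.comp, h0, sub_zero]
  exact div_nonneg (C.Ω_nonneg _) (sub_nonneg.2 (le_of_lt hs))

/-- A timelike curve with its ends in the interior lies in the interior. -/
lemma mapsTo_interior {γ : ℝ → M} {a b : ℝ} (h : C.IsTimelikeCurve γ a b)
    (ha : γ a ∈ (𝓡∂ 4).interior M) (hb : γ b ∈ (𝓡∂ 4).interior M) :
    MapsTo γ (Icc a b) ((𝓡∂ 4).interior M) := by
  intro s hs
  rcases hs.1.eq_or_lt with rfl | has
  · exact ha
  rcases hs.2.eq_or_lt with rfl | hsb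
  · exact hb
  exact C.mem_interior_iff.2
    ⟨notMem_scriPlus_of_timelikeJoined (h.timelikeJoined has.le le_rfl hsb),
      notMem_scriMinus_of_timelikeJoined (h.timelikeJoined le_rfl hsb.le has)⟩

end ConformalCompletion

end
end Penrose

/-! ### Light cone estimates from the asymptotic expansion -/

namespace Penrose

lemma abs_crossProduct_le (J : Fin 3 → ℝ) (x : E3) (i : Fin 3) :
    |crossProduct J x.ofLp i| ≤ 2 * (|J 0| + |J 1| + |J 2|) * ‖x‖ := by
  have hx : ∀ j, |x j| ≤ ‖x‖ := fun j => by simpa using PiLp.norm_apply_le x j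
  have key : ∀ j k l m : Fin 3, |J j * x k - J l * x m| ≤ (|J j| + |J l|) * ‖x‖ := by
    intro j k l m
    calc |J j * x k - J l * x m| ≤ |J j * x k| + |J l * x m| := abs_sub _ _
      _ = |J j| * |x k| + |J l| * |x m| := by rw [abs_mul, abs_mul]
      _ ≤ |J j| * ‖x‖ + |J l| * ‖x‖ := by gcongr <;> exact hx _
      _ = _ := by ring
  have h0 := abs_nonneg (J 0)
  have h1 := abs_nonneg (J 1)
  have h2 := abs_nonneg (J 2)
  have hn := norm_nonneg x
  rw [cross_apply]
  fin_cases i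
  · refine (key 1 2 2 1).trans ?_
    gcongr ?_ * _
    linarith
  · refine (key 2 0 0 2).trans ?_
    gcongr ?_ * _
    linarith
  · refine (key 0 1 1 0).trans ?_
    gcongr ?_ * _
    linarith

/-- The quadratic form of the metric differs from its Schwarzschildean part to first order in
`1 / r` by terms of second order. -/
lemma HasExpansion.exists_bound {m R : ℝ} {J : Fin 3 → ℝ} {k : ℝ × E3 → ℝ × E3 → ℝ × E3 → ℝ}
    (h : HasExpansion m R J k) :
    ∃ D : ℝ, 0 < D ∧ ∀ X ∈ endDomain R, 1 ≤ ‖X.2‖ → ∀ (τ : ℝ) (ξ : E3),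
      |k X (τ, ξ) (τ, ξ) - ((1 - 2 * m / ‖X.2‖) * τ ^ 2 - (1 + 2 * m / ‖X.2‖) * ‖ξ‖ ^ 2)| ≤
        D / ‖X.2‖ ^ 2 * (τ ^ 2 + ‖ξ‖ ^ 2) := by
  obtain ⟨F, F₁, F₂, K, hb, hk⟩ := h
  set j := |J 0| + |J 1| + |J 2| with hj
  have hj0 : 0 ≤ j := by positivity
  refine ⟨5 * m ^ 2 + 24 * j + 13 * |K| + 1, by positivity, fun X hX hr τ ξ => ?_⟩
  obtain ⟨hF, hF₁, hF₂⟩ := hb X hX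
  set r := ‖X.2‖ with hrdef
  have hr0 : 0 < r := by linarith
  have hdiv : ∀ y B : ℝ, |y| ≤ B * r → |y / r ^ 3| ≤ B / r ^ 2 := by
    intro y B hy
    rw [abs_div, abs_of_pos (pow_pos hr0 3), div_le_div_iff₀ (by positivity) (by positivity)]
    calc |y| * r ^ 2 ≤ B * r * r ^ 2 := by gcongr
      _ = B * r ^ 3 := by ring
  have hK : ∀ y : ℝ, |y| ≤ K → |y| ≤ |K| * r := fun y hy =>
    (hy.trans (le_abs_self K)).trans (le_mul_of_one_le_right (abs_nonneg _) hr)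
  set n := τ ^ 2 + ‖ξ‖ ^ 2 with hn
  have hξ : ∀ i, |ξ i| ≤ ‖ξ‖ := fun i => by simpa using PiLp.norm_apply_le ξ i
  have hτξ : ∀ i, |τ * ξ i| ≤ n := by
    intro i
    rw [abs_mul]
    have h1 : |τ| * |ξ i| ≤ |τ| * ‖ξ‖ := by gcongr; exact hξ i
    nlinarith [sq_nonneg (|τ| - ‖ξ‖), sq_abs τ, abs_nonneg τ, norm_nonneg ξ]
  have hξξ : ∀ i l, |ξ i * ξ l| ≤ n := by
    intro i l
    rw [abs_mul]
    have h1 : |ξ i| * |ξ l| ≤ ‖ξ‖ * ‖ξ‖ := by gcongr <;> exact hξ _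
    nlinarith [sq_nonneg τ]
  have hsq : ‖ξ‖ ^ 2 = ξ 0 * ξ 0 + ξ 1 * ξ 1 + ξ 2 * ξ 2 := by
    rw [EuclideanSpace.norm_sq_eq]
    simp [Fin.sum_univ_three, sq]
  have hprod : ∀ (y B z : ℝ), |y / r ^ 3| ≤ B / r ^ 2 → |z| ≤ n → 0 ≤ B →
      |y / r ^ 3 * z| ≤ B / r ^ 2 * n := by
    intro y B z hy hz hB
    rw [abs_mul]
    gcongr
  have e : k X (τ, ξ) (τ, ξ) - ((1 - 2 * m / r) * τ ^ 2 - (1 + 2 * m / r) * ‖ξ‖ ^ 2) =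
      (2 * m ^ 2 / r ^ 2 * τ ^ 2 - 3 / 2 * (m ^ 2 / r ^ 2) * ‖ξ‖ ^ 2) + F X / r ^ 3 * τ ^ 2
      + ∑ i, (4 * (crossProduct J X.2.ofLp i) + F₁ i X) / r ^ 3 * (τ * ξ i)
      - ∑ i, ∑ l, F₂ i l X / r ^ 3 * (ξ i * ξ l) := by
    rw [hk X hX, hsq]
    simp only [Fin.sum_univ_three, ← hrdef]
    simp [Fin.ext_iff]
    ring
  rw [e]
  have b0 : |2 * m ^ 2 / r ^ 2 * τ ^ 2 - 3 / 2 * (m ^ 2 / r ^ 2) * ‖ξ‖ ^ 2| ≤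
      5 * m ^ 2 / r ^ 2 * n := by
    have hm : 0 ≤ m ^ 2 / r ^ 2 := by positivity
    have h2 : 2 * m ^ 2 / r ^ 2 = 2 * (m ^ 2 / r ^ 2) := by ring
    have h5 : 5 * m ^ 2 / r ^ 2 = 5 * (m ^ 2 / r ^ 2) := by ring
    rw [h2, h5, abs_le]
    constructor <;>
      nlinarith [mul_nonneg hm (sq_nonneg τ), mul_nonneg hm (sq_nonneg ‖ξ‖)]
  have b1 : |F X / r ^ 3 * τ ^ 2| ≤ |K| / r ^ 2 * n := by
    refine hprod _ _ _ (hdiv _ _ (hK _ hF)) ?_ (abs_nonneg _)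
    rw [abs_of_nonneg (sq_nonneg τ), hn]
    nlinarith [sq_nonneg ‖ξ‖]
  have b2 : |∑ i, (4 * (crossProduct J X.2.ofLp i) + F₁ i X) / r ^ 3 * (τ * ξ i)| ≤
      3 * ((8 * j + |K|) / r ^ 2 * n) := by
    refine (Finset.abs_sum_le_sum_abs _ _).trans ((Finset.sum_le_card_nsmul _ _
      ((8 * j + |K|) / r ^ 2 * n) fun i _ => ?_).trans (by simp))
    refine hprod _ _ _ (hdiv _ _ ?_) (hτξ i) (by positivity)
    refine (abs_add_le _ _).trans ?_
    rw [abs_mul, abs_of_pos (by norm_num : (0 : ℝ) < 4)]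
    have := abs_crossProduct_le J X.2 i
    have := hK _ (hF₁ i)
    nlinarith
  have b3 : |∑ i, ∑ l, F₂ i l X / r ^ 3 * (ξ i * ξ l)| ≤ 9 * (|K| / r ^ 2 * n) := by
    refine (Finset.abs_sum_le_sum_abs _ _).trans ((Finset.sum_le_card_nsmul _ _
      (3 * (|K| / r ^ 2 * n)) fun i _ => ?_).trans (by simp; linarith))
    refine (Finset.abs_sum_le_sum_abs _ _).trans ((Finset.sum_le_card_nsmul _ _
      (|K| / r ^ 2 * n) fun l _ => ?_).trans (by simp))
    exact hprod _ _ _ (hdiv _ _ (hK _ (hF₂ i l))) (hξξ i l) (abs_nonneg _)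
  refine ((abs_sub _ _).trans (add_le_add ((abs_add_le _ _).trans (add_le_add
    ((abs_add_le _ _).trans (add_le_add b0 b1)) b2)) b3)).trans ?_
  have : 0 ≤ 1 / r ^ 2 * n := by positivity
  have e2 : (5 * m ^ 2 + 24 * j + 13 * |K| + 1) / r ^ 2 * n = 5 * m ^ 2 / r ^ 2 * n +
      |K| / r ^ 2 * n + 3 * ((8 * j + |K|) / r ^ 2 * n) + 9 * (|K| / r ^ 2 * n) +
        1 / r ^ 2 * n := by ring
  linarith

/-- A vector that is timelike for a metric close to `(1 + a) dt² - (1 - a) dx²` has coordinate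
speed at most `1 + a + …`. -/
lemma mul_le_of_cone {a d q k τ n : ℝ} (ha : 0 ≤ a) (ha' : a ≤ 1 / 8) (hd : 0 ≤ d)
    (hd' : d ≤ 1 / 8) (hq : 2 * d ≤ q) (hq' : q ≤ 1 / 8) (hτ : 0 < τ) (hk : 0 < k)
    (h : |k - ((1 + a) * τ ^ 2 - (1 - a) * n ^ 2)| ≤ d * (τ ^ 2 + n ^ 2)) :
    (1 - a - q) * n ≤ τ := by
  have hs : 0 ≤ 1 - a - q := by linarith
  have h1 : (1 - a - d) * n ^ 2 ≤ (1 + a + d) * τ ^ 2 := by linarith [(abs_le.1 h).2]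
  -- The smallest admissible $(\tau/n)^2$ is $(1-a-d)/(1+a+d)$, and this bounds it below by
  -- $(1-a-2d)^2$. No $a^2$ term is needed, because $(1-a)^2(1+a)\le 1-a$.
  have h2 : (1 - a - 2 * d) ^ 2 * (1 + a + d) ≤ 1 - a - d := by
    have e : (1 - a - 2 * d) ^ 2 * (1 + a + d) = (1 - a) * (1 - a ^ 2) + d * (1 - a) ^ 2
      - 4 * d * (1 + a + d) * (1 - a - d) := by ring
    have h3 : 3 * d ≤ 4 * d * (1 + a + d) * (1 - a - d) := by
      have : 3 / 4 ≤ (1 + a + d) * (1 - a - d) := by nlinarith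
      nlinarith
    have h4 : (1 - a) * (1 - a ^ 2) ≤ 1 - a := by nlinarith [sq_nonneg a]
    have h5 : d * (1 - a) ^ 2 ≤ d := by
      have : (1 - a) ^ 2 ≤ 1 := by nlinarith
      nlinarith
    linarith
  have h3 : ((1 - a - q) * n) ^ 2 ≤ τ ^ 2 := by
    have h4 : (1 - a - q) ^ 2 ≤ (1 - a - 2 * d) ^ 2 := by
      apply pow_le_pow_left₀ hs; linarith
    have h5 : (1 + a + d) * ((1 - a - q) * n) ^ 2 ≤ (1 + a + d) * τ ^ 2 := by
      calc (1 + a + d) * ((1 - a - q) * n) ^ 2 = (1 - a - q) ^ 2 * (1 + a + d) * n ^ 2 := by ring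
        _ ≤ (1 - a - 2 * d) ^ 2 * (1 + a + d) * n ^ 2 := by gcongr
        _ ≤ (1 - a - d) * n ^ 2 := by gcongr
        _ ≤ _ := h1
    exact le_of_mul_le_mul_left h5 (by linarith)
  exact le_of_abs_le (abs_le_of_sq_le_sq h3 hτ.le)

/-- A converse of `mul_le_of_cone`. -/
lemma pos_of_mul_le {a d q k τ n : ℝ} (ha : 0 ≤ a) (ha' : a ≤ 1 / 8) (hd : 0 < d)
    (hd' : d ≤ 1 / 8) (hq : 2 * d + a ^ 2 ≤ q) (hn : 0 ≤ n) (hτ : 0 < τ)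
    (hτn : (1 - a + q) * n ≤ τ)
    (h : |k - ((1 + a) * τ ^ 2 - (1 - a) * n ^ 2)| ≤ d * (τ ^ 2 + n ^ 2)) : 0 < k := by
  have h1 : (1 + a - d) * τ ^ 2 - (1 - a + d) * n ^ 2 ≤ k := by linarith [(abs_le.1 h).1]
  -- In this direction the $a^2$ in `hq` pays for the defect in $(1-a)^2(1+a)\le 1-a$. The left side
  -- has $2d$ instead of the required $d$; the surplus $d n^2$ gives the strict inequality.
  have h2 : 1 - a + 2 * d ≤ (1 + a - d) * (1 - a + q) ^ 2 := by
    have e : (1 + a - d) * (1 - a + q) ^ 2 = (1 - a) * (1 - a ^ 2) - d * (1 - a) ^ 2 +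
      2 * ((1 + a - d) * (1 - a)) * q + (1 + a - d) * q ^ 2 := by ring
    have h3 : 3 / 4 ≤ (1 + a - d) * (1 - a) := by nlinarith
    have h4 : 1 - a - a ^ 2 ≤ (1 - a) * (1 - a ^ 2) := by nlinarith [pow_nonneg ha 3]
    have h5 : d * (1 - a) ^ 2 ≤ d := by
      have : (1 - a) ^ 2 ≤ 1 := by nlinarith
      nlinarith
    have h6 : 0 ≤ (1 + a - d) * q ^ 2 := mul_nonneg (by linarith) (sq_nonneg _)
    have h7 : 3 / 2 * (2 * d + a ^ 2) ≤ 2 * ((1 + a - d) * (1 - a)) * q := by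
      have : 0 ≤ 2 * d + a ^ 2 := by positivity
      nlinarith
    nlinarith [sq_nonneg a]
  rcases hn.eq_or_lt with rfl | hn
  · refine lt_of_lt_of_le ?_ h1
    have : 0 < τ ^ 2 := by positivity
    nlinarith
  · have hs : 0 ≤ 1 - a + q := by nlinarith [sq_nonneg a]
    have h3 : ((1 - a + q) * n) ^ 2 ≤ τ ^ 2 := pow_le_pow_left₀ (by positivity) hτn 2
    have h4 : (1 - a + 2 * d) * n ^ 2 ≤ (1 + a - d) * τ ^ 2 := by
      calc (1 - a + 2 * d) * n ^ 2 ≤ (1 + a - d) * (1 - a + q) ^ 2 * n ^ 2 := by gcongr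
        _ = (1 + a - d) * ((1 - a + q) * n) ^ 2 := by ring
        _ ≤ _ := by gcongr; linarith
    have : 0 < d * n ^ 2 := by positivity
    nlinarith

end Penrose

/-! ### The tortoise coordinate and the far region -/

namespace Penrose

noncomputable section

/-- A tortoise coordinate for a negative mass `-μ`, with a term of order `1 / r`. -/
def tort (μ A r : ℝ) : ℝ := r - 2 * μ * Real.log r + A / r

/-- The derivative of `tort`. -/
def tortDeriv (μ A r : ℝ) : ℝ := 1 - 2 * μ / r - A / r ^ 2

lemma hasDerivAt_tort (μ A : ℝ) {r : ℝ} (hr : r ≠ 0) :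
    HasDerivAt (tort μ A) (tortDeriv μ A r) r := by
  have h := ((hasDerivAt_id r).sub ((Real.hasDerivAt_log hr).const_mul (2 * μ))).add
    ((hasDerivAt_inv hr).const_mul A)
  refine (h.congr_deriv ?_).congr_of_eventuallyEq (Eventually.of_forall fun x => ?_)
  · simp only [tortDeriv]
    ring
  · simp [tort, div_eq_mul_inv]

lemma continuousAt_tort (μ A : ℝ) {r : ℝ} (hr : r ≠ 0) : ContinuousAt (tort μ A) r :=
  (hasDerivAt_tort μ A hr).continuousAt

lemma tendsto_const_div_atTop (B : ℝ) : Tendsto (fun r : ℝ => B / r) atTop (𝓝 0) :=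
  tendsto_const_nhds.div_atTop tendsto_id

lemma tendsto_const_div_sq_atTop (B : ℝ) : Tendsto (fun r : ℝ => B / r ^ 2) atTop (𝓝 0) :=
  tendsto_const_nhds.div_atTop (tendsto_pow_atTop two_ne_zero)

lemma tendsto_tortDeriv_atTop (μ A : ℝ) : Tendsto (tortDeriv μ A) atTop (𝓝 1) := by
  have := (tendsto_const_nhds (x := (1 : ℝ))).sub (tendsto_const_div_atTop (2 * μ)) |>.sub
    (tendsto_const_div_sq_atTop A)
  simp only [sub_zero] at this
  exact this

lemma tendsto_tort_atTop (μ A : ℝ) : Tendsto (tort μ A) atTop atTop := by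
  have h1 : Tendsto (fun r : ℝ => Real.log r / r) atTop (𝓝 0) :=
    Real.isLittleO_log_id_atTop.tendsto_div_nhds_zero
  have h2 : Tendsto (fun r : ℝ => 1 - 2 * μ * (Real.log r / r)) atTop (𝓝 1) := by
    simpa using (h1.const_mul (2 * μ)).const_sub 1
  have h3 := (tendsto_id.atTop_mul_pos one_pos h2).atTop_add (tendsto_const_div_atTop A)
  refine h3.congr' ?_
  filter_upwards [eventually_gt_atTop 0] with r hr
  simp only [tort, id]
  field_simp

/-- The place where the sign of the mass decides: $f'-f/r=\big(2\mu(\log r-1)-2A/r\big)/r$, and the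
logarithm wins with the sign of $\mu$. -/
lemma eventually_tort_div_le {μ : ℝ} (hμ : 0 < μ) (A : ℝ) :
    ∀ᶠ r in atTop, tort μ A r / r ≤ tortDeriv μ A r := by
  have h1 : ∀ᶠ r in atTop, 2 * A / r < μ :=
    (tendsto_const_div_atTop (2 * A)).eventually (gt_mem_nhds hμ)
  have h2 : ∀ᶠ r in atTop, 2 ≤ Real.log r := Real.tendsto_log_atTop.eventually_ge_atTop 2
  filter_upwards [h1, h2, eventually_gt_atTop 0] with r h1 h2 hr
  have e : tortDeriv μ A r - tort μ A r / r = (2 * μ * (Real.log r - 1) - 2 * A / r) / r := by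
    simp only [tort, tortDeriv]
    field_simp
    ring
  have : 0 ≤ (2 * μ * (Real.log r - 1) - 2 * A / r) / r :=
    div_nonneg (by nlinarith) hr.le
  linarith

end

variable {M : Type*} [TopologicalSpace M] [ChartedSpace (EuclideanHalfSpace 4) M]
  [IsManifold (𝓡∂ 4) 1 M] {C : ConformalCompletion M} {m : ℝ} (e : StationaryVacuumEnd C m)

namespace StationaryVacuumEnd

/-- The vector at `chart X` with components `V`. -/
noncomputable def pushforward (X V : ℝ × E3) : TangentSpace (𝓡∂ 4) (e.chart X) :=
  mfderiv 𝓘(ℝ, ℝ × E3) (𝓡∂ 4) e.chart X V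

lemma pushforward_add (X V W : ℝ × E3) :
    e.pushforward X (V + W) = e.pushforward X V + e.pushforward X W :=
  map_add (mfderiv 𝓘(ℝ, ℝ × E3) (𝓡∂ 4) e.chart X) V W

lemma pushforward_smul (X V : ℝ × E3) (c : ℝ) :
    e.pushforward X (c • V) = c • e.pushforward X V :=
  map_smul (mfderiv 𝓘(ℝ, ℝ × E3) (𝓡∂ 4) e.chart X) c V

lemma pushforward_neg (X V : ℝ × E3) : e.pushforward X (-V) = -e.pushforward X V :=
  map_neg (mfderiv 𝓘(ℝ, ℝ × E3) (𝓡∂ 4) e.chart X) V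

lemma chart_mem_interior {X : ℝ × E3} (hX : X ∈ endDomain e.R) :
    e.chart X ∈ (𝓡∂ 4).interior M :=
  e.chart_target (e.chart.map_source (e.chart_source ▸ hX))

lemma chartMetric_pos_iff {X : ℝ × E3} (hX : X ∈ endDomain e.R) (V : ℝ × E3) :
    0 < C.chartMetric e.chart X V V ↔
      0 < C.g (e.chart X) (e.pushforward X V) (e.pushforward X V) := by
  have := C.Ω_pos _ (e.chart_mem_interior hX)
  exact mul_pos_iff_of_pos_left (by positivity)

/-- A radius `radius` and a constant `A` such that for `r ≥ radius` the light cones are estimated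
by means of `tortDeriv`. -/
structure FarRegion (μ : ℝ) where
  A : ℝ
  radius : ℝ
  one_le : 1 ≤ radius
  R_lt : e.R < radius
  cone : ∀ X : ℝ × E3, radius ≤ ‖X.2‖ → ∀ (τ : ℝ) (ξ : E3),
    C.FutureTimelike (e.chart X) (e.pushforward X (τ, ξ)) →
      0 < τ ∧ tortDeriv μ A ‖X.2‖ * ‖ξ‖ ≤ τ
  timelike : ∀ X : ℝ × E3, radius ≤ ‖X.2‖ → ∀ (τ : ℝ) (ξ : E3), 0 < τ →
    tortDeriv μ (-A) ‖X.2‖ * ‖ξ‖ ≤ τ → C.FutureTimelike (e.chart X) (e.pushforward X (τ, ξ))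
  tortDeriv_pos : ∀ r, radius ≤ r → 0 < tortDeriv μ A r
  tortDeriv_neg_pos : ∀ r, radius ≤ r → 0 < tortDeriv μ (-A) r
  tortDeriv_neg_le : ∀ r, radius ≤ r → tortDeriv μ (-A) r ≤ 2
  tort_nonneg : ∀ r, radius ≤ r → 0 ≤ tort μ A r
  tort_div_le : ∀ r, radius ≤ r → tort μ A r / r ≤ tortDeriv μ A r
  tort_neg_close : ∀ r, radius ≤ r → |tort μ A r - tort μ (-A) r| ≤ 1
  c : ℝ
  rstar_close : ∀ r, radius ≤ r → |e.rstar r - tort μ A r - c| ≤ 1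

theorem exists_farRegion (hm : m < 0) : Nonempty (e.FarRegion (-m)) := by
  obtain ⟨D, hD, hbound⟩ := e.expansion.exists_bound
  obtain ⟨c, hc⟩ := e.rstar_asymptotics
  set μ := -m with hμ
  have hμ0 : 0 < μ := by linarith
  -- With $d=D/r^2$ and $a=2\mu/r$ one gets $A/r^2=2d+a^2$, the margin that `pos_of_mul_le` needs;
  -- `mul_le_of_cone` needs only $2d$.
  set A := 2 * D + 4 * μ ^ 2 with hA
  have hA0 : 0 < A := by positivity
  have ev1 : ∀ᶠ r : ℝ in atTop, 2 * μ / r < 1 / 8 :=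
    (tendsto_const_div_atTop _).eventually (gt_mem_nhds (by norm_num))
  have ev2 : ∀ᶠ r : ℝ in atTop, D / r ^ 2 < 1 / 8 :=
    (tendsto_const_div_sq_atTop _).eventually (gt_mem_nhds (by norm_num))
  have ev3 : ∀ᶠ r : ℝ in atTop, A / r ^ 2 < 1 / 8 :=
    (tendsto_const_div_sq_atTop _).eventually (gt_mem_nhds (by norm_num))
  have ev4 : ∀ᶠ r : ℝ in atTop, 0 < tortDeriv μ A r :=
    (tendsto_tortDeriv_atTop μ A).eventually (lt_mem_nhds one_pos)
  have ev5 : ∀ᶠ r : ℝ in atTop, 0 < tortDeriv μ (-A) r ∧ tortDeriv μ (-A) r < 2 :=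
    (tendsto_tortDeriv_atTop μ (-A)).eventually (Ioo_mem_nhds one_pos one_lt_two)
  have ev6 : ∀ᶠ r : ℝ in atTop, 0 ≤ tort μ A r := (tendsto_tort_atTop μ A).eventually_ge_atTop 0
  have ev7 := eventually_tort_div_le hμ0 A
  have ev8 : ∀ᶠ r : ℝ in atTop, 2 * A / r < 1 :=
    (tendsto_const_div_atTop _).eventually (gt_mem_nhds one_pos)
  have ev9 : ∀ᶠ r : ℝ in atTop, |e.rstar r - tort μ A r - c| < 1 := by
    have h : Tendsto (fun r => e.rstar r - tort μ A r - c) atTop (𝓝 0) := by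
      have := (hc.sub (tendsto_const_div_atTop A)).sub_const c
      simp only [sub_zero, sub_self] at this
      refine this.congr fun r => ?_
      simp only [tort, hμ]
      ring
    have := h.abs
    rw [abs_zero] at this
    exact this.eventually (gt_mem_nhds one_pos)
  obtain ⟨r₀, hr₀⟩ := eventually_atTop.1 (ev1.and (ev2.and (ev3.and (ev4.and (ev5.and (ev6.and
    (ev7.and (ev8.and ev9))))))))
  have hR : ∀ r, max (max 1 (e.R + 1)) r₀ ≤ r → 1 ≤ r ∧ e.R < r ∧ r₀ ≤ r := by
    intro r hr
    simp only [max_le_iff] at hr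
    exact ⟨hr.1.1, by linarith [hr.1.2], hr.2⟩
  have hform : ∀ X : ℝ × E3, e.R < ‖X.2‖ → 1 ≤ ‖X.2‖ → ∀ (τ : ℝ) (ξ : E3),
      |C.chartMetric e.chart X (τ, ξ) (τ, ξ) - ((1 + 2 * μ / ‖X.2‖) * τ ^ 2
        - (1 - 2 * μ / ‖X.2‖) * ‖ξ‖ ^ 2)| ≤ D / ‖X.2‖ ^ 2 * (τ ^ 2 + ‖ξ‖ ^ 2) := by
    intro X hX hX1 τ ξ
    have := hbound X hX hX1 τ ξ
    rw [hμ]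
    convert this using 3
    ring
  have cone : ∀ X : ℝ × E3, max (max 1 (e.R + 1)) r₀ ≤ ‖X.2‖ → ∀ (τ : ℝ) (ξ : E3),
      C.FutureTimelike (e.chart X) (e.pushforward X (τ, ξ)) →
        0 < τ ∧ tortDeriv μ A ‖X.2‖ * ‖ξ‖ ≤ τ := by
    intro X hX τ ξ hV
    obtain ⟨h1, hXR, h2⟩ := hR _ hX
    obtain ⟨e1, e2, e3, -⟩ := hr₀ _ h2
    have hr : 0 < ‖X.2‖ := by linarith
    -- If $\tau\le0$, adding $-\tau\,\partial_t$ would keep the vector future timelike and make it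
    -- $(0,\xi)$, on which the metric is nonpositive.
    have hτ : 0 < τ := by
      by_contra hτ
      have h3 := hV.add_smul (e.future_time X hXR) (neg_nonneg.2 (not_lt.1 hτ))
      have h4 : e.pushforward X (τ, ξ) + (-τ) • e.pushforward X (1, 0) =
          e.pushforward X (0, ξ) := by
        rw [← pushforward_smul, ← pushforward_add]
        simp
      have h5 : 0 < C.chartMetric e.chart X (0, ξ) (0, ξ) := by
        rw [e.chartMetric_pos_iff hXR, ← h4]
        exact h3.1
      have h6 := (abs_le.1 (hform X hXR h1 0 ξ)).2
      have h7 := sq_nonneg ‖ξ‖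
      nlinarith
    refine ⟨hτ, ?_⟩
    have hk := (e.chartMetric_pos_iff hXR (τ, ξ)).2 hV.1
    refine mul_le_of_cone (by positivity) e1.le (by positivity) e2.le ?_ e3.le
      hτ hk (hform X hXR h1 τ ξ)
    rw [hA, ← mul_div_assoc]
    gcongr
    nlinarith
  refine ⟨⟨A, max (max 1 (e.R + 1)) r₀, (hR _ le_rfl).1, (hR _ le_rfl).2.1, cone, ?_,
    fun r hr => (hr₀ r (hR r hr).2.2).2.2.2.1, fun r hr => (hr₀ r (hR r hr).2.2).2.2.2.2.1.1,
    fun r hr => (hr₀ r (hR r hr).2.2).2.2.2.2.1.2.le,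
    fun r hr => (hr₀ r (hR r hr).2.2).2.2.2.2.2.1, fun r hr => (hr₀ r (hR r hr).2.2).2.2.2.2.2.2.1,
    ?_, c, fun r hr => (hr₀ r (hR r hr).2.2).2.2.2.2.2.2.2.2.le⟩⟩
  · intro X hX τ ξ hτ hτξ
    obtain ⟨h1, hXR, h2⟩ := hR _ hX
    obtain ⟨e1, e2, e3, -⟩ := hr₀ _ h2
    have hr : 0 < ‖X.2‖ := by linarith
    have hk : 0 < C.chartMetric e.chart X (τ, ξ) (τ, ξ) := by
      refine pos_of_mul_le (q := A / ‖X.2‖ ^ 2) (n := ‖ξ‖) (τ := τ) (by positivity) e1.le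
        (by positivity) e2.le (le_of_eq ?_) (norm_nonneg _) hτ ?_ (hform X hXR h1 τ ξ)
      · rw [hA]
        ring
      · convert hτξ using 2
        simp only [tortDeriv]
        ring
    rw [e.chartMetric_pos_iff hXR] at hk
    -- The vector is timelike; were it past directed, the cone estimate for its negative would give
    -- $-\tau>0$.
    refine (Spacetime.futureTimelike_or_neg hk).resolve_right fun hneg => ?_
    rw [← pushforward_neg] at hneg
    have := (cone X hX (-τ) (-ξ) hneg).1
    linarith
  · intro r hr
    obtain ⟨h1, -, h2⟩ := hR _ hr
    obtain ⟨-, -, -, -, -, -, -, e8, -⟩ := hr₀ _ h2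
    have : tort μ A r - tort μ (-A) r = 2 * A / r := by
      simp only [tort]
      ring
    rw [this, abs_of_nonneg (by positivity)]
    exact e8.le

end StationaryVacuumEnd

end Penrose

/-! ### Explicit timelike curves in the far region -/

namespace Penrose

lemma exists_unit_orthogonal (a b : E3) :
    ∃ n : E3, ‖n‖ = 1 ∧ inner ℝ a n = 0 ∧ inner ℝ b n = 0 := by
  let f : E3 →ₗ[ℝ] ℝ × ℝ := (innerₛₗ ℝ a).prod (innerₛₗ ℝ b)
  have hf : LinearMap.ker f ≠ ⊥ := LinearMap.ker_ne_bot_of_finrank_lt (by simp)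
  obtain ⟨n, hn, hn0⟩ := (Submodule.ne_bot_iff _).1 hf
  have hn' : inner ℝ a n = 0 ∧ inner ℝ b n = 0 := by
    simpa [f] using hn
  refine ⟨‖n‖⁻¹ • n, ?_, ?_, ?_⟩
  · rw [norm_smul, norm_inv, norm_norm, inv_mul_cancel₀ (norm_ne_zero_iff.2 hn0)]
  · rw [inner_smul_right, hn'.1, mul_zero]
  · rw [inner_smul_right, hn'.2, mul_zero]

/-- A chord of a quarter circle stays away from the centre. -/
lemma le_norm_chord {a n : E3} (ha : ‖a‖ = 1) (hn : ‖n‖ = 1) (h : inner ℝ a n = 0)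
    (ρ s : ℝ) : ρ ≤ ‖(2 * ρ) • a + s • ((2 * ρ) • n - (2 * ρ) • a)‖ := by
  refine le_of_sq_le_sq ?_ (norm_nonneg _)
  have e : (2 * ρ) • a + s • ((2 * ρ) • n - (2 * ρ) • a) =
      (2 * ρ * (1 - s)) • a + (2 * ρ * s) • n := by
    module
  rw [e, norm_add_sq_real, norm_smul, norm_smul, inner_smul_left, inner_smul_right, h, ha, hn]
  simp only [Real.norm_eq_abs, mul_one, mul_zero, add_zero, sq_abs]
  nlinarith [mul_nonneg (sq_nonneg ρ) (sq_nonneg (2 * s - 1)), sq_nonneg ρ]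

variable {M : Type*} [TopologicalSpace M] [ChartedSpace (EuclideanHalfSpace 4) M]
  [IsManifold (𝓡∂ 4) 1 M] {C : ConformalCompletion M} {m : ℝ} {e : StationaryVacuumEnd C m}

lemma isOpen_endDomain (R : ℝ) : IsOpen (endDomain R) :=
  isOpen_lt continuous_const continuous_snd.norm

namespace StationaryVacuumEnd

lemma contMDiffOn_chart_endDomain (e : StationaryVacuumEnd C m) :
    ContMDiffOn 𝓘(ℝ, ℝ × E3) (𝓡∂ 4) 1 e.chart (endDomain e.R) :=
  e.chart_source ▸ e.contMDiffOn_chart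

namespace FarRegion

variable {μ : ℝ} (P : e.FarRegion μ)

lemma radius_pos : 0 < P.radius := one_pos.trans_le P.one_le

/-- Retarded time. -/
noncomputable def U (X : ℝ × E3) : ℝ := X.1 - tort μ P.A ‖X.2‖

/-- Advanced time. -/
noncomputable def V (X : ℝ × E3) : ℝ := X.1 + tort μ P.A ‖X.2‖

include P in
lemma mem_endDomain {X : ℝ × E3} (hX : P.radius ≤ ‖X.2‖) : X ∈ endDomain e.R :=
  P.R_lt.trans_le hX

lemma timelikeJoined_of_curve {c c' : ℝ → ℝ × E3} {a b : ℝ} (hab : a < b)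
    (hc : ContDiffOn ℝ 1 c (Icc a b)) (hc' : ∀ s ∈ Icc a b, HasDerivAt c (c' s) s)
    (hr : ∀ s ∈ Icc a b, P.radius ≤ ‖(c s).2‖)
    (hv : ∀ s ∈ Icc a b,
      0 < (c' s).1 ∧ tortDeriv μ (-P.A) ‖(c s).2‖ * ‖(c' s).2‖ ≤ (c' s).1) :
    C.TimelikeJoined (e.chart (c a)) (e.chart (c b)) := by
  refine ⟨e.chart ∘ c, a, b, Spacetime.isTimelikeCurve_comp e.contMDiffOn_chart_endDomain hab hc
    (fun s hs => (hc' s hs).hasDerivWithinAt) (fun s hs => P.mem_endDomain (hr s hs))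
    fun s hs => ?_, rfl, rfl⟩
  rw [mfderivWithin_of_isOpen (isOpen_endDomain _) (P.mem_endDomain (hr s hs))]
  exact P.timelike (c s) (hr s hs) _ _ (hv s hs).1 (hv s hs).2

lemma contDiffOn_tort {A : ℝ} {s : Set ℝ} (hs : ∀ r ∈ s, r ≠ 0) :
    ContDiffOn ℝ 1 (tort μ A) s := by
  have h := (contDiffOn_id (𝕜 := ℝ) (n := 1) (s := s)).sub
    (contDiffOn_const.mul (contDiffOn_id.log hs)) (𝕜 := ℝ) (g := fun r => 2 * μ * Real.log r)
  exact h.add (contDiffOn_const.div contDiffOn_id hs)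

/-- The radial curve with $dt/dr$ equal to `tortDeriv μ (-P.A) r`. The opposite sign of $A$ makes it
slower than light, and changes the elapsed time only by a bounded amount. -/
lemma timelikeJoined_outward {w : E3} (hw : ‖w‖ = 1) {r₁ r₂ : ℝ} (h₁ : P.radius ≤ r₁)
    (h₂ : r₁ < r₂) (t : ℝ) :
    C.TimelikeJoined (e.chart (t - tort μ (-P.A) r₂ + tort μ (-P.A) r₁, r₁ • w))
      (e.chart (t, r₂ • w)) := by
  have hpos : ∀ s ∈ Icc r₁ r₂, 0 < s := fun s hs => (P.radius_pos.trans_le h₁).trans_le hs.1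
  have hnorm : ∀ s ∈ Icc r₁ r₂, ‖s • w‖ = s := fun s hs => by
    rw [norm_smul, hw, mul_one, Real.norm_of_nonneg (hpos s hs).le]
  have := P.timelikeJoined_of_curve
    (c := fun s => (t - tort μ (-P.A) r₂ + tort μ (-P.A) s, s • w))
    (c' := fun s => (tortDeriv μ (-P.A) s, w)) h₂ ?_ ?_ ?_ ?_
  · simpa using this
  · exact (contDiffOn_const.add (contDiffOn_tort fun r hr => (hpos r hr).ne')).prodMk
      (contDiffOn_id.smul contDiffOn_const)
  · intro s hs
    have h := ((hasDerivAt_tort μ (-P.A) (hpos s hs).ne').const_add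
      (t - tort μ (-P.A) r₂)).prodMk ((hasDerivAt_id s).smul_const w)
    simpa using h
  · intro s hs
    simpa [hnorm s hs] using h₁.trans hs.1
  · intro s hs
    refine ⟨P.tortDeriv_neg_pos s (h₁.trans hs.1), ?_⟩
    simp [hnorm s hs, hw]

lemma timelikeJoined_inward {w : E3} (hw : ‖w‖ = 1) {r₁ r₂ : ℝ} (h₁ : P.radius ≤ r₁)
    (h₂ : r₁ < r₂) (t : ℝ) :
    C.TimelikeJoined (e.chart (t, r₂ • w))
      (e.chart (t + tort μ (-P.A) r₂ - tort μ (-P.A) r₁, r₁ • w)) := by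
  have hmem : ∀ s ∈ Icc (-r₂) (-r₁), -s ∈ Icc r₁ r₂ := fun s hs =>
    ⟨by linarith [hs.2], by linarith [hs.1]⟩
  have hpos : ∀ s ∈ Icc r₁ r₂, 0 < s := fun s hs => (P.radius_pos.trans_le h₁).trans_le hs.1
  have hnorm : ∀ s ∈ Icc r₁ r₂, ‖s • w‖ = s := fun s hs => by
    rw [norm_smul, hw, mul_one, Real.norm_of_nonneg (hpos s hs).le]
  have := P.timelikeJoined_of_curve
    (c := fun s => (t + tort μ (-P.A) r₂ - tort μ (-P.A) (-s), (-s) • w))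
    (c' := fun s => (tortDeriv μ (-P.A) (-s), -w)) (neg_lt_neg h₂) ?_ ?_ ?_ ?_
  · simpa using this
  · refine (contDiffOn_const.sub ((contDiffOn_tort (s := Icc r₁ r₂)
      fun r hr => (hpos r hr).ne').comp contDiffOn_id.neg hmem)).prodMk
      (contDiffOn_id.neg.smul contDiffOn_const)
  · intro s hs
    have h := (((hasDerivAt_tort μ (-P.A) (hpos _ (hmem s hs)).ne').comp s
      (hasDerivAt_id s).neg).const_sub (t + tort μ (-P.A) r₂)).prodMk
      ((hasDerivAt_id s).neg.smul_const w)
    simpa using h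
  · intro s hs
    dsimp only
    rw [hnorm _ (hmem s hs)]
    exact h₁.trans (hmem s hs).1
  · intro s hs
    refine ⟨P.tortDeriv_neg_pos _ (h₁.trans (hmem s hs).1), ?_⟩
    dsimp only
    rw [hnorm _ (hmem s hs), norm_neg, hw, mul_one]

/-- Coordinate speed at most $1/2$ is timelike throughout the far region, by `tortDeriv_neg_le`. -/
lemma timelikeJoined_segment {x y : E3} {Δ : ℝ} (hΔ : 0 < Δ) (hxy : 2 * ‖y - x‖ ≤ Δ)
    (hr : ∀ s ∈ Icc (0 : ℝ) 1, P.radius ≤ ‖x + s • (y - x)‖) (t : ℝ) :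
    C.TimelikeJoined (e.chart (t, x)) (e.chart (t + Δ, y)) := by
  have := P.timelikeJoined_of_curve (c := fun s => (t + s * Δ, x + s • (y - x)))
    (c' := fun s => (Δ, y - x)) (zero_lt_one' ℝ) (by fun_prop) ?_ hr ?_
  · simpa using this
  · intro s _
    have h := (((hasDerivAt_id s).mul_const Δ).const_add t).prodMk
      (((hasDerivAt_id s).smul_const (y - x)).const_add x)
    simpa using h
  · intro s hs
    refine ⟨hΔ, le_trans ?_ hxy⟩
    exact mul_le_mul_of_nonneg_right (P.tortDeriv_neg_le _ (hr s hs)) (norm_nonneg _)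

lemma le_norm_radial {w : E3} (hw : ‖w‖ = 1) {r₁ r₂ : ℝ} (h₁ : P.radius ≤ r₁)
    (h₂ : P.radius ≤ r₂) {s : ℝ} (hs : s ∈ Icc (0 : ℝ) 1) :
    P.radius ≤ ‖r₁ • w + s • (r₂ • w - r₁ • w)‖ := by
  have e : r₁ • w + s • (r₂ • w - r₁ • w) = (r₁ + s * (r₂ - r₁)) • w := by module
  rw [e, norm_smul, hw, mul_one]
  refine le_trans ?_ (le_abs_self _)
  nlinarith [hs.1, hs.2]

lemma norm_radial_sub_le {w : E3} (hw : ‖w‖ = 1) {r₁ r₂ : ℝ} (h₁ : 0 ≤ r₁) (h₂ : r₁ ≤ r₂) :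
    ‖r₂ • w - r₁ • w‖ ≤ r₂ := by
  rw [← sub_smul, norm_smul, hw, mul_one, Real.norm_of_nonneg (by linarith)]
  linarith

/-- From outside the sphere of radius `2 * P.radius` a radial curve leads inward; the `2` is the
cost of exchanging `tort μ (-P.A)` for `tort μ P.A` at both ends. From inside, a radial segment of
duration `4 * P.radius` suffices. -/
lemma exists_timelikeJoined_to_sphere {X : ℝ × E3} (hX : P.radius ≤ ‖X.2‖) :
    ∃ t ≤ P.V X + (4 * P.radius + 2), C.TimelikeJoined (e.chart X)
      (e.chart (t, (2 * P.radius) • ‖X.2‖⁻¹ • X.2)) := by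
  have h0 := P.radius_pos
  have hr : 0 < ‖X.2‖ := h0.trans_le hX
  have hw : ‖‖X.2‖⁻¹ • X.2‖ = 1 := by
    rw [norm_smul, norm_inv, norm_norm, inv_mul_cancel₀ hr.ne']
  have hx : X = (X.1, ‖X.2‖ • ‖X.2‖⁻¹ • X.2) := by rw [smul_inv_smul₀ hr.ne']
  have hT := P.tort_nonneg _ hX
  rcases lt_or_ge (2 * P.radius) ‖X.2‖ with h | h
  · have hj := P.timelikeJoined_inward hw (by linarith : P.radius ≤ 2 * P.radius) h X.1
    rw [← hx] at hj
    refine ⟨_, ?_, hj⟩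
    have h1 := abs_le.1 (P.tort_neg_close _ hX)
    have h2 := abs_le.1 (P.tort_neg_close _ (by linarith : P.radius ≤ 2 * P.radius))
    have h3 := P.tort_nonneg _ (by linarith : P.radius ≤ 2 * P.radius)
    rw [V]
    linarith [h1.1, h2.2]
  · have hj := P.timelikeJoined_segment (x := ‖X.2‖ • ‖X.2‖⁻¹ • X.2)
      (y := (2 * P.radius) • ‖X.2‖⁻¹ • X.2) (Δ := 4 * P.radius) (by linarith)
      (by linarith [norm_radial_sub_le hw hr.le h])
      (fun s hs => P.le_norm_radial hw hX (by linarith) hs) X.1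
    rw [← hx] at hj
    refine ⟨_, ?_, hj⟩
    rw [V]
    linarith

lemma exists_timelikeJoined_from_sphere {X : ℝ × E3} (hX : P.radius ≤ ‖X.2‖) :
    ∃ t ≥ P.U X - (4 * P.radius + 2), C.TimelikeJoined
      (e.chart (t, (2 * P.radius) • ‖X.2‖⁻¹ • X.2)) (e.chart X) := by
  have h0 := P.radius_pos
  have hr : 0 < ‖X.2‖ := h0.trans_le hX
  have hw : ‖‖X.2‖⁻¹ • X.2‖ = 1 := by
    rw [norm_smul, norm_inv, norm_norm, inv_mul_cancel₀ hr.ne']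
  have hx : X = (X.1, ‖X.2‖ • ‖X.2‖⁻¹ • X.2) := by rw [smul_inv_smul₀ hr.ne']
  have hT := P.tort_nonneg _ hX
  rcases lt_or_ge (2 * P.radius) ‖X.2‖ with h | h
  · have hj := P.timelikeJoined_outward hw (by linarith : P.radius ≤ 2 * P.radius) h X.1
    rw [← hx] at hj
    refine ⟨_, ?_, hj⟩
    have h1 := abs_le.1 (P.tort_neg_close _ hX)
    have h2 := abs_le.1 (P.tort_neg_close _ (by linarith : P.radius ≤ 2 * P.radius))
    have h3 := P.tort_nonneg _ (by linarith : P.radius ≤ 2 * P.radius)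
    rw [U]
    linarith [h1.1, h2.2]
  · have hj := P.timelikeJoined_segment (x := (2 * P.radius) • ‖X.2‖⁻¹ • X.2)
      (y := ‖X.2‖ • ‖X.2‖⁻¹ • X.2) (Δ := 4 * P.radius) (by linarith)
      (by rw [norm_sub_rev]; linarith [norm_radial_sub_le hw hr.le h])
      (fun s hs => P.le_norm_radial hw (by linarith) hX hs) (X.1 - 4 * P.radius)
    rw [sub_add_cancel, ← hx] at hj
    refine ⟨_, ?_, hj⟩
    rw [U]
    linarith

/-- A straight chord between nearly opposite points would leave the far region. The detour over a
direction `n` orthogonal to both uses two quarter circle chords, which stay at radius at least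
`P.radius`; each takes time at most `8 * P.radius` at speed $1/2$. -/
lemma mem_chronFuture_sphere {a b : E3} (ha : ‖a‖ = 1) (hb : ‖b‖ = 1) {t t' : ℝ}
    (ht : t + 16 * P.radius ≤ t') :
    e.chart (t', (2 * P.radius) • b) ∈ C.chronFuture (e.chart (t, (2 * P.radius) • a)) := by
  obtain ⟨n, hn, han, hbn⟩ := exists_unit_orthogonal a b
  have h0 := P.radius_pos
  have hdist : ∀ x y : E3, ‖x‖ = 1 → ‖y‖ = 1 →
      2 * ‖(2 * P.radius) • y - (2 * P.radius) • x‖ ≤ 8 * P.radius := by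
    intro x y hx hy
    have : ‖y - x‖ ≤ 2 := (norm_sub_le _ _).trans (by rw [hx, hy]; norm_num)
    rw [← smul_sub, norm_smul, Real.norm_of_nonneg (by linarith)]
    nlinarith
  have j1 := P.timelikeJoined_segment (by linarith : 0 < 8 * P.radius) (hdist a n ha hn)
    (fun s _ => le_norm_chord ha hn han _ s) t
  have j2 := P.timelikeJoined_segment (by linarith : 0 < t' - (t + 8 * P.radius))
    ((hdist n b hn hb).trans (by linarith))
    (fun s _ => le_norm_chord hn hb (by rw [real_inner_comm, hbn]) _ s) (t + 8 * P.radius)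
  rw [add_sub_cancel] at j2
  exact (Relation.TransGen.single j1).tail j2

/-- A point of the far region whose retarded time is much larger than the advanced time of another
one lies in the chronological future of the latter. -/
lemma mem_chronFuture_of_le {X Y : ℝ × E3} (hX : P.radius ≤ ‖X.2‖) (hY : P.radius ≤ ‖Y.2‖)
    (h : P.V Y + (24 * P.radius + 4) ≤ P.U X) :
    e.chart X ∈ C.chronFuture (e.chart Y) := by
  -- Time budget: `4 * P.radius + 2` to reach the sphere, the same to leave it, and `16 * P.radius`
  -- to move around on it.
  obtain ⟨t, ht, hj⟩ := P.exists_timelikeJoined_to_sphere hY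
  obtain ⟨t', ht', hj'⟩ := P.exists_timelikeJoined_from_sphere hX
  have hunit : ∀ x : E3, P.radius ≤ ‖x‖ → ‖‖x‖⁻¹ • x‖ = 1 := by
    intro x hx
    rw [norm_smul, norm_inv, norm_norm, inv_mul_cancel₀ (P.radius_pos.trans_le hx).ne']
  exact ((Relation.TransGen.single hj).trans
    (P.mem_chronFuture_sphere (hunit _ hY) (hunit _ hX) (by linarith))).tail hj'

end FarRegion

end StationaryVacuumEnd

end Penrose

/-! ### Time functions in the far region -/

namespace Penrose

lemma hasDerivAt_norm_of_ne {x : ℝ → E3} {ξ : E3} {s : ℝ} (h : HasDerivAt x ξ s) (h0 : x s ≠ 0) :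
    HasDerivAt (fun s => ‖x s‖) (inner ℝ (‖x s‖⁻¹ • x s) ξ) s := by
  have h1 := h.norm_sq.sqrt (pow_ne_zero 2 (norm_ne_zero_iff.2 h0))
  simp only [Real.sqrt_sq (norm_nonneg _)] at h1
  refine h1.congr_deriv ?_
  rw [inner_smul_left]
  simp only [conj_trivial]
  have := norm_ne_zero_iff.2 h0
  field_simp

/-- The gradient of `cos θ f(r)` is at most `p` when `f' = p` and `0 ≤ f / r = q ≤ p`. -/
lemma inner_gradient_le {w n : E3} (hw : ‖w‖ = 1) (hn : ‖n‖ = 1) {p q : ℝ} (hq : 0 ≤ q)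
    (hqp : q ≤ p) (ξ : E3) :
    (p - q) * inner ℝ w n * inner ℝ n ξ + q * inner ℝ w ξ ≤ p * ‖ξ‖ := by
  set G := ((p - q) * inner ℝ w n) • n + q • w with hG
  have hGn : ‖G‖ ≤ p := by
    refine le_of_sq_le_sq ?_ (hq.trans hqp)
    have hc1 : |inner ℝ w n| ≤ 1 := by simpa [hw, hn] using abs_real_inner_le_norm w n
    have hc2 : (inner ℝ w n) ^ 2 ≤ 1 := by
      rw [← sq_abs]
      exact pow_le_one₀ (abs_nonneg _) hc1
    rw [hG, norm_add_sq_real, norm_smul, norm_smul, real_inner_smul_left, real_inner_smul_right,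
      hw, hn, real_inner_comm w n]
    simp only [Real.norm_eq_abs, mul_one, sq_abs]
    -- With $c=\langle w,n\rangle$ one has $|G|^2=c^2p^2+(1-c^2)q^2$, so
    -- $p^2-|G|^2=(p^2-q^2)(1-c^2)$.
    nlinarith [mul_nonneg (sub_nonneg.2 (pow_le_pow_left₀ hq hqp 2)) (sub_nonneg.2 hc2)]
  have hGe : inner ℝ G ξ = (p - q) * inner ℝ w n * inner ℝ n ξ + q * inner ℝ w ξ := by
    rw [hG, inner_add_left, real_inner_smul_left, real_inner_smul_left]
  rw [← hGe]
  exact (real_inner_le_norm G ξ).trans (mul_le_mul_of_nonneg_right hGn (norm_nonneg _))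

variable {M : Type*} [TopologicalSpace M] [ChartedSpace (EuclideanHalfSpace 4) M]
  [IsManifold (𝓡∂ 4) 1 M] {C : ConformalCompletion M} {m : ℝ} {e : StationaryVacuumEnd C m}

namespace StationaryVacuumEnd

/-- The coordinates `(t, x)` of a timelike curve and their derivative. -/
lemma exists_hasDerivWithinAt_coordinates (e : StationaryVacuumEnd C m) {γ : ℝ → M} {a b s : ℝ}
    (hγ : C.IsTimelikeCurve γ a b) (hs : s ∈ Icc a b) (hmem : γ s ∈ e.chart.target) :
    ∃ v : ℝ × E3, HasDerivWithinAt (e.chart.symm ∘ γ) v (Icc a b) s ∧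
      C.FutureTimelike (e.chart (e.chart.symm (γ s))) (e.pushforward (e.chart.symm (γ s)) v) := by
  have hd : MDifferentiableAt (𝓡∂ 4) 𝓘(ℝ, ℝ × E3) e.chart.symm (γ s) :=
    ((e.contMDiffOn_chart_symm _ hmem).contMDiffAt
      (e.chart.open_target.mem_nhds hmem)).mdifferentiableAt one_ne_zero
  refine ⟨_, hγ.hasDerivWithinAt_comp hs hd, ?_⟩
  have hX : e.chart.symm (γ s) ∈ e.chart.source := e.chart.map_target hmem
  have hd' : MDifferentiableAt 𝓘(ℝ, ℝ × E3) (𝓡∂ 4) e.chart (e.chart.symm (γ s)) :=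
    ((e.contMDiffOn_chart _ hX).contMDiffAt
      (e.chart.open_source.mem_nhds hX)).mdifferentiableAt one_ne_zero
  have h1 := hd'.hasMFDerivAt.comp (γ s) hd.hasMFDerivAt
  have h2 : HasMFDerivAt (𝓡∂ 4) (𝓡∂ 4) (e.chart ∘ e.chart.symm) (γ s)
      (ContinuousLinearMap.id ℝ (TangentSpace (𝓡∂ 4) (γ s))) := by
    refine (hasMFDerivAt_id (γ s)).congr_of_eventuallyEq ?_
    filter_upwards [e.chart.open_target.mem_nhds hmem] with x hx
    exact e.chart.right_inv hx
  have h3 := hasMFDerivAt_unique h1 h2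
  have key : ∀ p : M, p = γ s → ∀ v : EuclideanSpace ℝ (Fin 4),
      v = mfderivWithin 𝓘(ℝ, ℝ) (𝓡∂ 4) γ (Icc a b) s (1 : ℝ) →
      C.FutureTimelike p (v : TangentSpace (𝓡∂ 4) p) := by
    rintro p rfl v rfl
    exact hγ.2.2 s hs
  exact key _ (e.chart.right_inv hmem) _ (DFunLike.congr_fun h3 _)

namespace FarRegion

variable {μ : ℝ} (P : e.FarRegion μ)

/-- The points of the end with `r > radius`. -/
def region : Set M := {p | p ∈ e.chart.target ∧ P.radius < ‖(e.chart.symm p).2‖}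

lemma isOpen_region : IsOpen P.region :=
  e.chart.isOpen_inter_preimage_symm (isOpen_endDomain P.radius)

lemma chart_mem_region {X : ℝ × E3} (hX : P.radius < ‖X.2‖) : e.chart X ∈ P.region := by
  have h : X ∈ e.chart.source := e.chart_source ▸ P.mem_endDomain hX.le
  refine ⟨e.chart.map_source h, ?_⟩
  rwa [e.chart.left_inv h]

lemma symm_chart {X : ℝ × E3} (hX : P.radius ≤ ‖X.2‖) : e.chart.symm (e.chart X) = X :=
  e.chart.left_inv (e.chart_source ▸ P.mem_endDomain hX)

lemma region_subset_interior : P.region ⊆ (𝓡∂ 4).interior M :=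
  fun _ h => e.chart_target h.1

/-- `f` does not decrease along curves that satisfy the bound on the speed of light. -/
def IsTimeFunction (f : ℝ × E3 → ℝ) : Prop :=
  ∀ (c : ℝ → ℝ × E3) (v : ℝ × E3) (s : ℝ), HasDerivAt c v s → P.radius ≤ ‖(c s).2‖ →
    tortDeriv μ P.A ‖(c s).2‖ * ‖v.2‖ ≤ v.1 → ∃ d ≥ 0, HasDerivAt (f ∘ c) d s

variable {P}

/-- The cone estimate turns the timelike condition into the slope condition of `IsTimeFunction`, so
the derivative is nonnegative on the open interval; continuity takes care of the ends. -/
lemma IsTimeFunction.monotoneOn {f : ℝ × E3 → ℝ} (hf : P.IsTimeFunction f)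
    (hfc : ∀ X : ℝ × E3, P.radius ≤ ‖X.2‖ → ContinuousAt f X) {γ : ℝ → M} {a b s₁ s₂ : ℝ}
    (hγ : C.IsTimelikeCurve γ a b) (h₁ : a ≤ s₁) (h₂ : s₂ ≤ b)
    (hmem : MapsTo γ (Icc s₁ s₂) P.region) :
    MonotoneOn (fun s => f (e.chart.symm (γ s))) (Icc s₁ s₂) := by
  have hsub : Icc s₁ s₂ ⊆ Icc a b := Icc_subset_Icc h₁ h₂
  have hd : ∀ s ∈ Ioo s₁ s₂, ∃ d ≥ 0, HasDerivAt (fun s => f (e.chart.symm (γ s))) d s := by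
    intro s hs
    have hs' := hmem (Ioo_subset_Icc_self hs)
    obtain ⟨v, hv, hvt⟩ := e.exists_hasDerivWithinAt_coordinates hγ
      (hsub (Ioo_subset_Icc_self hs)) hs'.1
    have hv' : HasDerivAt (e.chart.symm ∘ γ) v s :=
      hv.hasDerivAt (Icc_mem_nhds (h₁.trans_lt hs.1) (hs.2.trans_le h₂))
    exact hf _ v s hv' hs'.2.le (P.cone _ hs'.2.le v.1 v.2 hvt).2
  refine monotoneOn_of_deriv_nonneg (convex_Icc _ _) ?_ ?_ ?_
  · intro s hs
    obtain ⟨v, hv, -⟩ := e.exists_hasDerivWithinAt_coordinates hγ (hsub hs) (hmem hs).1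
    have hv' : ContinuousWithinAt (e.chart.symm ∘ γ) (Icc a b) s := hv.continuousWithinAt
    exact (ContinuousAt.comp_continuousWithinAt (f := e.chart.symm ∘ γ) (hfc _ (hmem hs).2.le)
      hv').mono hsub
  · rw [interior_Icc]
    intro s hs
    obtain ⟨d, -, hd⟩ := hd s hs
    exact hd.differentiableAt.differentiableWithinAt
  · rw [interior_Icc]
    intro s hs
    obtain ⟨d, hd0, hd⟩ := hd s hs
    rw [hd.deriv]
    exact hd0

variable (P)

lemma ne_zero_of_le {x : E3} (hx : P.radius ≤ ‖x‖) : x ≠ 0 :=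
  norm_pos_iff.1 (P.radius_pos.trans_le hx)

lemma hasDerivAt_tort_norm {c : ℝ → ℝ × E3} {v : ℝ × E3} {s : ℝ} (hc : HasDerivAt c v s)
    (hr : P.radius ≤ ‖(c s).2‖) : HasDerivAt (fun s => tort μ P.A ‖(c s).2‖)
      (tortDeriv μ P.A ‖(c s).2‖ * inner ℝ (‖(c s).2‖⁻¹ • (c s).2) v.2) s :=
  HasDerivAt.comp (h := fun s => ‖(c s).2‖) (h₂ := tort μ P.A) s
    (hasDerivAt_tort μ P.A (norm_ne_zero_iff.2 (P.ne_zero_of_le hr)))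
    (hasDerivAt_norm_of_ne hc.snd (P.ne_zero_of_le hr))

lemma norm_unit {x : E3} (hx : P.radius ≤ ‖x‖) : ‖‖x‖⁻¹ • x‖ = 1 := by
  rw [norm_smul, norm_inv, norm_norm, inv_mul_cancel₀ (norm_ne_zero_iff.2 (P.ne_zero_of_le hx))]

lemma abs_inner_unit_le {x : E3} (hx : P.radius ≤ ‖x‖) (ξ : E3) :
    |inner ℝ (‖x‖⁻¹ • x) ξ| ≤ ‖ξ‖ := by
  simpa [P.norm_unit hx] using abs_real_inner_le_norm (‖x‖⁻¹ • x) ξ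

lemma isTimeFunction_U : P.IsTimeFunction P.U := by
  intro c v s hc hr hv
  have ht : HasDerivAt (fun s => (c s).1) v.1 s := hc.fst
  refine ⟨_, ?_, HasDerivAt.sub ht (P.hasDerivAt_tort_norm hc hr)⟩
  have h1 := (abs_le.1 (P.abs_inner_unit_le hr v.2)).2
  have h2 := mul_le_mul_of_nonneg_left h1 (P.tortDeriv_pos _ hr).le
  linarith

lemma isTimeFunction_V : P.IsTimeFunction P.V := by
  intro c v s hc hr hv
  have ht : HasDerivAt (fun s => (c s).1) v.1 s := hc.fst
  refine ⟨_, ?_, HasDerivAt.add ht (P.hasDerivAt_tort_norm hc hr)⟩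
  have h1 := (abs_le.1 (P.abs_inner_unit_le hr v.2)).1
  have h2 := mul_le_mul_of_nonneg_left h1 (P.tortDeriv_pos _ hr).le
  linarith

/-- The time function `t - cos θ r_*`, with `θ` the angle from the axis `w`; it interpolates
between advanced time in the direction `-w` and retarded time in the direction `w`. -/
noncomputable def Φ (w : E3) (X : ℝ × E3) : ℝ :=
  X.1 - inner ℝ w X.2 * (tort μ P.A ‖X.2‖ / ‖X.2‖)

/-- By the quotient rule the spatial term of the derivative is the gradient of $\cos\theta\,f(r)$
applied to the velocity, which `inner_gradient_le` controls once $f/r\le f'$. -/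
lemma isTimeFunction_Φ {w : E3} (hw : ‖w‖ = 1) : P.IsTimeFunction (P.Φ w) := by
  intro c v s hc hr hv
  have hr0 : 0 < ‖(c s).2‖ := P.radius_pos.trans_le hr
  set n := ‖(c s).2‖⁻¹ • (c s).2 with hn
  set p := tortDeriv μ P.A ‖(c s).2‖ with hp
  set q := tort μ P.A ‖(c s).2‖ / ‖(c s).2‖ with hq
  have hn1 : ‖n‖ = 1 := P.norm_unit hr
  have hx : (c s).2 = ‖(c s).2‖ • n := by rw [hn, smul_inv_smul₀ hr0.ne']
  have hquot := (P.hasDerivAt_tort_norm hc hr).div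
    (hasDerivAt_norm_of_ne hc.snd (P.ne_zero_of_le hr)) hr0.ne'
  have hin : HasDerivAt (fun s => inner ℝ w (c s).2) (inner ℝ w v.2) s := by
    simpa using (hasDerivAt_const s w).inner ℝ hc.snd
  have ht : HasDerivAt (fun s => (c s).1) v.1 s := hc.fst
  refine ⟨_, ?_, HasDerivAt.sub ht (HasDerivAt.mul hin hquot)⟩
  have hq0 : 0 ≤ q := div_nonneg (P.tort_nonneg _ hr) hr0.le
  have hqp : q ≤ p := P.tort_div_le _ hr
  have hGv := (inner_gradient_le hw hn1 hq0 hqp v.2).trans hv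
  have hwx : inner ℝ w (c s).2 = ‖(c s).2‖ * inner ℝ w n := by
    conv_lhs => rw [hx, inner_smul_right]
  have hT : tort μ P.A ‖(c s).2‖ = q * ‖(c s).2‖ := by
    rw [hq, div_mul_cancel₀ _ hr0.ne']
  simp only [hwx, hT]
  have e2 : inner ℝ w v.2 * (q * ‖(c s).2‖ / ‖(c s).2‖) + ‖(c s).2‖ * inner ℝ w n *
      ((p * inner ℝ n v.2 * ‖(c s).2‖ - q * ‖(c s).2‖ * inner ℝ n v.2) / ‖(c s).2‖ ^ 2) =
      (p - q) * inner ℝ w n * inner ℝ n v.2 + q * inner ℝ w v.2 := by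
    field_simp
    ring
  linarith

lemma continuousAt_tort_norm {X : ℝ × E3} (hX : P.radius ≤ ‖X.2‖) :
    ContinuousAt (fun X : ℝ × E3 => tort μ P.A ‖X.2‖) X :=
  (continuousAt_tort μ P.A (norm_ne_zero_iff.2 (P.ne_zero_of_le hX))).comp
    (f := fun X : ℝ × E3 => ‖X.2‖) continuousAt_snd.norm

lemma continuousAt_U {X : ℝ × E3} (hX : P.radius ≤ ‖X.2‖) : ContinuousAt P.U X :=
  continuousAt_fst.sub (P.continuousAt_tort_norm hX)

lemma continuousAt_V {X : ℝ × E3} (hX : P.radius ≤ ‖X.2‖) : ContinuousAt P.V X :=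
  continuousAt_fst.add (P.continuousAt_tort_norm hX)

lemma continuousAt_Φ (w : E3) {X : ℝ × E3} (hX : P.radius ≤ ‖X.2‖) : ContinuousAt (P.Φ w) X :=
  continuousAt_fst.sub ((continuousAt_const.inner continuousAt_snd).mul
    ((P.continuousAt_tort_norm hX).div continuousAt_snd.norm
      (norm_ne_zero_iff.2 (P.ne_zero_of_le hX))))

end FarRegion

end StationaryVacuumEnd

end Penrose

/-! ### Limits at null infinity and curves that leave the far region -/

namespace Penrose

variable {M : Type*} [TopologicalSpace M] [ChartedSpace (EuclideanHalfSpace 4) M]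
  [IsManifold (𝓡∂ 4) 1 M] {C : ConformalCompletion M} {m : ℝ} {e : StationaryVacuumEnd C m}

/-- The point of the model of future null infinity with retarded time `u` and direction `w`. -/
noncomputable def scriPlusPoint (u : ℝ) (w : E3) : ℝ × ℝ × E3 :=
  (Real.pi / 2 + Real.arctan u, Real.pi / 2 - Real.arctan u, w)

/-- The point of the model of past null infinity with advanced time `v` and direction `w`. -/
noncomputable def scriMinusPoint (v : ℝ) (w : E3) : ℝ × ℝ × E3 :=
  (Real.arctan v - Real.pi / 2, Real.arctan v + Real.pi / 2, w)

lemma scriPlusPoint_mem (u : ℝ) {w : E3} (hw : ‖w‖ = 1) : scriPlusPoint u w ∈ modelScriPlus := by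
  have h1 := Real.neg_pi_div_two_lt_arctan u
  have h2 := Real.arctan_lt_pi_div_two u
  refine ⟨⟨?_, ?_⟩, ?_, hw⟩ <;> simp only [scriPlusPoint] <;> linarith

lemma scriMinusPoint_mem (v : ℝ) {w : E3} (hw : ‖w‖ = 1) :
    scriMinusPoint v w ∈ modelScriMinus := by
  have h1 := Real.neg_pi_div_two_lt_arctan v
  have h2 := Real.arctan_lt_pi_div_two v
  refine ⟨⟨?_, ?_⟩, ?_, hw⟩ <;> simp only [scriMinusPoint] <;> linarith

namespace StationaryVacuumEnd

lemma tendsto_chart (e : StationaryVacuumEnd C m) {ι : Type*} {l : Filter ι} {X : ι → ℝ × E3}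
    {Y : ℝ × ℝ × E3} (hY : Y ∈ compactDomain e.R e.rstar) (hX : ∀ᶠ i in l, X i ∈ endDomain e.R)
    (h : Tendsto (fun i => compactCoord e.rstar (X i)) l (𝓝 Y)) :
    Tendsto (fun i => e.chart (X i)) l (𝓝 (e.compactChart Y)) := by
  have hc : ContinuousOn e.compactChart (compactDomain e.R e.rstar) :=
    continuousOn_iff_continuous_domRestrict.2 e.isOpenEmbedding_compactChart.continuous
  have h1 : Tendsto (fun i => compactCoord e.rstar (X i)) l
      (𝓝[compactDomain e.R e.rstar] Y) := by
    refine tendsto_nhdsWithin_iff.2 ⟨h, ?_⟩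
    filter_upwards [hX] with i hi
    exact Or.inl (Or.inl ⟨X i, hi, rfl⟩)
  refine ((hc Y hY).tendsto.comp h1).congr' ?_
  filter_upwards [hX] with i hi
  exact e.compactChart_compactCoord _ hi

namespace FarRegion

variable {μ : ℝ} (P : e.FarRegion μ)

include P in
lemma tendsto_rstar : Tendsto e.rstar atTop atTop := by
  refine tendsto_atTop_mono' _ ?_
    (tendsto_atTop_add_const_right _ (P.c - 1) (tendsto_tort_atTop μ P.A))
  filter_upwards [eventually_ge_atTop P.radius] with r hr
  linarith [(abs_le.1 (P.rstar_close r hr)).1]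

lemma strictMonoOn_tort : StrictMonoOn (tort μ P.A) (Ici P.radius) := by
  have h0 : ∀ r ∈ Ici P.radius, r ≠ 0 := fun r hr => (P.radius_pos.trans_le hr).ne'
  refine strictMonoOn_of_deriv_pos (convex_Ici _)
    (fun r hr => (continuousAt_tort _ _ (h0 r hr)).continuousWithinAt) fun r hr => ?_
  have hr' : r ∈ Ici P.radius := interior_subset hr
  rw [(hasDerivAt_tort _ _ (h0 r hr')).deriv]
  exact P.tortDeriv_pos r hr'

include P in
lemma tendsto_scriPlus {ι : Type*} {l : Filter ι} {X : ι → ℝ × E3} {u : ℝ} {w : E3}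
    (hw : ‖w‖ = 1) (hr : Tendsto (fun i => ‖(X i).2‖) l atTop)
    (hu : Tendsto (fun i => (X i).1 - e.rstar ‖(X i).2‖) l (𝓝 u))
    (hX : Tendsto (fun i => ‖(X i).2‖⁻¹ • (X i).2) l (𝓝 w)) :
    Tendsto (fun i => e.chart (X i)) l (𝓝 (e.compactChart (scriPlusPoint u w))) := by
  refine e.tendsto_chart (Or.inl (Or.inr (scriPlusPoint_mem u hw)))
    (hr.eventually_gt_atTop e.R) ?_
  have hv : Tendsto (fun i => (X i).1 + e.rstar ‖(X i).2‖) l atTop := by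
    have h := hu.add_atTop ((P.tendsto_rstar.comp hr).const_mul_atTop two_pos)
    refine h.congr fun i => ?_
    simp only [Function.comp]
    ring
  have hv' := (tendsto_nhds_of_tendsto_nhdsWithin Real.tendsto_arctan_atTop).comp hv
  have hu' := (Real.continuous_arctan.tendsto u).comp hu
  exact (hv'.add hu').prodMk_nhds ((hv'.sub hu').prodMk_nhds hX)

include P in
lemma tendsto_scriMinus {ι : Type*} {l : Filter ι} {X : ι → ℝ × E3} {v : ℝ} {w : E3}
    (hw : ‖w‖ = 1) (hr : Tendsto (fun i => ‖(X i).2‖) l atTop)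
    (hv : Tendsto (fun i => (X i).1 + e.rstar ‖(X i).2‖) l (𝓝 v))
    (hX : Tendsto (fun i => ‖(X i).2‖⁻¹ • (X i).2) l (𝓝 w)) :
    Tendsto (fun i => e.chart (X i)) l (𝓝 (e.compactChart (scriMinusPoint v w))) := by
  refine e.tendsto_chart (Or.inr (scriMinusPoint_mem v hw))
    (hr.eventually_gt_atTop e.R) ?_
  have hu : Tendsto (fun i => (X i).1 - e.rstar ‖(X i).2‖) l atBot := by
    have h := hv.add_atBot ((P.tendsto_rstar.comp hr).const_mul_atTop_of_neg
      (by norm_num : (-2 : ℝ) < 0))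
    refine h.congr fun i => ?_
    simp only [Function.comp]
    ring
  have hu' := (tendsto_nhds_of_tendsto_nhdsWithin Real.tendsto_arctan_atBot).comp hu
  have hv' := (Real.continuous_arctan.tendsto v).comp hv
  have h := (hv'.add hu').prodMk_nhds ((hv'.sub hu').prodMk_nhds hX)
  rw [sub_neg_eq_add, ← sub_eq_add_neg] at h
  exact h

variable [T2Space M]

/-- The coordinates stay in a compact subset of the chart domain, and limits in a Hausdorff space
are unique. The margin `+ 1` survives the limit and yields the strict inequality of the open region.
-/
lemma mem_region_of_bounded {𝒰 : Ultrafilter (ℝ × E3)} {p : M} {B : ℝ}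
    (hr : ∀ᶠ X in (𝒰 : Filter (ℝ × E3)), P.radius + 1 ≤ ‖X.2‖)
    (hB : ∀ᶠ X in (𝒰 : Filter (ℝ × E3)), ‖X‖ ≤ B) (hp : Tendsto e.chart 𝒰 (𝓝 p)) :
    p ∈ P.region := by
  have hK : IsCompact (Metric.closedBall (0 : ℝ × E3) B ∩ {X | P.radius + 1 ≤ ‖X.2‖}) :=
    (isCompact_closedBall _ _).inter_right (isClosed_le continuous_const continuous_snd.norm)
  have hle : (𝒰 : Filter (ℝ × E3)) ≤
      𝓟 (Metric.closedBall (0 : ℝ × E3) B ∩ {X | P.radius + 1 ≤ ‖X.2‖}) := by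
    rw [le_principal_iff]
    filter_upwards [hr, hB] with X h1 h2
    exact ⟨mem_closedBall_zero_iff.2 h2, h1⟩
  obtain ⟨X, ⟨-, hX⟩, h𝒰⟩ := hK.ultrafilter_le_nhds 𝒰 hle
  have hX' : P.radius < ‖X.2‖ := by linarith [hX.out]
  have hc : ContinuousAt e.chart X :=
    e.chart.continuousAt (e.chart_source ▸ P.mem_endDomain hX'.le)
  rw [tendsto_nhds_unique hp (hc.tendsto.mono_left h𝒰)]
  exact P.chart_mem_region hX'

omit [T2Space M] in
/-- Directions converge along an ultrafilter. -/
lemma exists_tendsto_direction {𝒰 : Ultrafilter (ℝ × E3)}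
    (hr : ∀ᶠ X in (𝒰 : Filter (ℝ × E3)), P.radius + 1 ≤ ‖X.2‖) :
    ∃ w : E3, ‖w‖ = 1 ∧ Tendsto (fun X : ℝ × E3 => ‖X.2‖⁻¹ • X.2) 𝒰 (𝓝 w) := by
  have hle : ((𝒰.map fun X : ℝ × E3 => ‖X.2‖⁻¹ • X.2 : Ultrafilter E3) : Filter E3) ≤
      𝓟 (Metric.sphere (0 : E3) 1) := by
    rw [le_principal_iff, Ultrafilter.coe_map, mem_map]
    filter_upwards [hr] with X h1
    exact mem_sphere_zero_iff_norm.2 (P.norm_unit (by linarith))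
  obtain ⟨w, hw, h⟩ := (isCompact_sphere (0 : E3) 1).ultrafilter_le_nhds _ hle
  exact ⟨w, mem_sphere_zero_iff_norm.1 hw, h⟩

lemma exists_tendsto_of_bounded {ι : Type*} {𝒰 : Ultrafilter ι} {f : ι → ℝ} {a b : ℝ}
    (h : ∀ᶠ i in (𝒰 : Filter ι), f i ∈ Icc a b) : ∃ y, Tendsto f 𝒰 (𝓝 y) := by
  obtain ⟨y, -, hy⟩ := (isCompact_Icc (a := a) (b := b)).ultrafilter_le_nhds (𝒰.map f)
    (le_principal_iff.2 h)
  exact ⟨y, hy⟩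

lemma bounded_or_tendsto_atTop {ι : Type*} (𝒰 : Ultrafilter ι) (f : ι → ℝ) :
    (∃ N, ∀ᶠ i in (𝒰 : Filter ι), f i ≤ N) ∨ Tendsto f 𝒰 atTop := by
  by_cases h : ∃ N, ∀ᶠ i in (𝒰 : Filter ι), f i ≤ N
  · exact Or.inl h
  · refine Or.inr (tendsto_atTop.2 fun N => ?_)
    push Not at h
    exact (h N).mono fun i hi => hi.le

/-- Along an ultrafilter either $r$ is bounded, and then so is $t$, or $r\to\infty$; in the latter
case $t-r_*$ and the direction converge, so the limit lies on future null infinity. -/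
lemma mem_of_retarded_bounded {𝒰 : Ultrafilter (ℝ × E3)} {p : M} {a b : ℝ}
    (hr : ∀ᶠ X in (𝒰 : Filter (ℝ × E3)), P.radius + 1 ≤ ‖X.2‖)
    (hU : ∀ᶠ X in (𝒰 : Filter (ℝ × E3)), P.U X ∈ Icc a b) (hp : Tendsto e.chart 𝒰 (𝓝 p)) :
    p ∈ P.region ∨ p ∈ C.scriPlus := by
  rcases bounded_or_tendsto_atTop 𝒰 fun X : ℝ × E3 => ‖X.2‖ with ⟨N, hN⟩ | hN
  · left
    refine P.mem_region_of_bounded (B := max (max (-a) (b + tort μ P.A N)) N) hr ?_ hp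
    filter_upwards [hr, hU, hN] with X h1 h2 h3
    have h4 := P.tort_nonneg ‖X.2‖ (by linarith)
    have h5 := P.strictMonoOn_tort.monotoneOn (a := ‖X.2‖) (b := N) (by simp; linarith)
      (by simp; linarith) h3
    simp only [U, mem_Icc] at h2
    refine norm_prod_le_iff.2 ⟨?_, h3.trans (le_max_right _ _)⟩
    rw [Real.norm_eq_abs]
    refine le_trans (abs_le.2 ⟨?_, ?_⟩) (le_max_left _ _)
    · have := le_max_left (-a) (b + tort μ P.A N)
      linarith
    · have := le_max_right (-a) (b + tort μ P.A N)
      linarith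
  · right
    obtain ⟨w, hw, hdir⟩ := P.exists_tendsto_direction hr
    obtain ⟨u, hu⟩ := exists_tendsto_of_bounded (𝒰 := 𝒰) (a := a - P.c - 1) (b := b - P.c + 1)
      (f := fun X : ℝ × E3 => X.1 - e.rstar ‖X.2‖) <| by
        filter_upwards [hr, hU] with X h1 h2
        have h3 := abs_le.1 (P.rstar_close ‖X.2‖ (by linarith))
        simp only [U, mem_Icc] at h2
        constructor <;> linarith [h3.1, h3.2]
    rw [tendsto_nhds_unique hp (P.tendsto_scriPlus hw hN hu hdir)]
    exact e.compactChart_scriPlus _ (scriPlusPoint_mem u hw)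

lemma mem_of_advanced_bounded {𝒰 : Ultrafilter (ℝ × E3)} {p : M} {a b : ℝ}
    (hr : ∀ᶠ X in (𝒰 : Filter (ℝ × E3)), P.radius + 1 ≤ ‖X.2‖)
    (hV : ∀ᶠ X in (𝒰 : Filter (ℝ × E3)), P.V X ∈ Icc a b) (hp : Tendsto e.chart 𝒰 (𝓝 p)) :
    p ∈ P.region ∨ p ∈ C.scriMinus := by
  rcases bounded_or_tendsto_atTop 𝒰 fun X : ℝ × E3 => ‖X.2‖ with ⟨N, hN⟩ | hN
  · left
    refine P.mem_region_of_bounded (B := max (max (tort μ P.A N - a) b) N) hr ?_ hp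
    filter_upwards [hr, hV, hN] with X h1 h2 h3
    have h4 := P.tort_nonneg ‖X.2‖ (by linarith)
    have h5 := P.strictMonoOn_tort.monotoneOn (a := ‖X.2‖) (b := N) (by simp; linarith)
      (by simp; linarith) h3
    simp only [V, mem_Icc] at h2
    refine norm_prod_le_iff.2 ⟨?_, h3.trans (le_max_right _ _)⟩
    rw [Real.norm_eq_abs]
    refine le_trans (abs_le.2 ⟨?_, ?_⟩) (le_max_left _ _)
    · have := le_max_left (tort μ P.A N - a) b
      linarith
    · have := le_max_right (tort μ P.A N - a) b
      linarith
  · right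
    obtain ⟨w, hw, hdir⟩ := P.exists_tendsto_direction hr
    obtain ⟨v, hv⟩ := exists_tendsto_of_bounded (𝒰 := 𝒰) (a := a + P.c - 1) (b := b + P.c + 1)
      (f := fun X : ℝ × E3 => X.1 + e.rstar ‖X.2‖) <| by
        filter_upwards [hr, hV] with X h1 h2
        have h3 := abs_le.1 (P.rstar_close ‖X.2‖ (by linarith))
        simp only [V, mem_Icc] at h2
        constructor <;> linarith [h3.1, h3.2]
    rw [tendsto_nhds_unique hp (P.tendsto_scriMinus hw hN hv hdir)]
    exact e.compactChart_scriMinus _ (scriMinusPoint_mem v hw)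

omit [T2Space M] in
-- Because $V-U=2f(r)$ and $f$ is increasing, a large gap between advanced and retarded time keeps a
-- point away from the inner boundary.
lemma le_norm_of_le {X : ℝ × E3} (hX : P.radius < ‖X.2‖)
    (h : 2 * tort μ P.A (P.radius + 1) ≤ P.V X - P.U X) : P.radius + 1 ≤ ‖X.2‖ := by
  by_contra hlt
  have := P.strictMonoOn_tort (a := ‖X.2‖) (b := P.radius + 1) hX.le (by simp) (not_le.1 hlt)
  simp only [U, V] at h
  linarith

/-- A timelike curve that leaves the far region towards the future attains a late retarded time
there. -/
lemma exists_retarded_ge {γ : ℝ → M} {a b : ℝ} (hγ : C.IsTimelikeCurve γ a b)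
    (hint : MapsTo γ (Icc a b) ((𝓡∂ 4).interior M)) (ha : γ a ∈ P.region)
    (hex : ∃ s ∈ Icc a b, γ s ∉ P.region) :
    ∃ s ∈ Icc a b, γ s ∈ P.region ∧
      P.V (e.chart.symm (γ a)) - 2 * tort μ P.A (P.radius + 1) ≤ P.U (e.chart.symm (γ s)) := by
  by_contra! hcon
  have hcont : ContinuousOn γ (Icc a b) := hγ.2.1.continuousOn
  have hS : IsClosed (Icc a b ∩ γ ⁻¹' P.regionᶜ) :=
    hcont.preimage_isClosed_of_isClosed isClosed_Icc P.isOpen_region.isClosed_compl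
  have hScomp : IsCompact (Icc a b ∩ γ ⁻¹' P.regionᶜ) :=
    isCompact_Icc.of_isClosed_subset hS inter_subset_left
  have hSne : (Icc a b ∩ γ ⁻¹' P.regionᶜ).Nonempty := hex
  -- The first exit parameter. The limit of the curve there is studied along an ultrafilter that is
  -- finer than the left neighbourhoods of `s₁`.
  set s₁ := sInf (Icc a b ∩ γ ⁻¹' P.regionᶜ) with hs₁
  obtain ⟨hs₁ab, hs₁r⟩ : s₁ ∈ Icc a b ∩ γ ⁻¹' P.regionᶜ := hScomp.sInf_mem hSne
  have has₁ : a < s₁ := hs₁ab.1.lt_of_ne fun h => hs₁r (h ▸ ha)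
  have hreg : ∀ s ∈ Ico a s₁, γ s ∈ P.region := by
    intro s hs
    by_contra h
    exact notMem_of_lt_csInf hs.2 hScomp.bddBelow
      ⟨⟨hs.1, hs.2.le.trans hs₁ab.2⟩, h⟩
  have hev : ∀ᶠ s in 𝓝[<] s₁, s ∈ Ico a s₁ := Ico_mem_nhdsLT has₁
  set 𝒰 : Ultrafilter (ℝ × E3) := (Ultrafilter.of (𝓝[<] s₁)).map (fun s => e.chart.symm (γ s))
    with h𝒰
  have h𝒰ev : ∀ p : ℝ × E3 → Prop, (∀ s ∈ Ico a s₁, p (e.chart.symm (γ s))) →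
      ∀ᶠ X in (𝒰 : Filter (ℝ × E3)), p X := by
    intro p hp
    have : ∀ᶠ s in 𝓝[<] s₁, p (e.chart.symm (γ s)) := hev.mono hp
    exact this.filter_mono (Ultrafilter.of_le _)
  have hlim : Tendsto e.chart 𝒰 (𝓝 (γ s₁)) := by
    have h1 : Tendsto γ (𝓝[<] s₁) (𝓝 (γ s₁)) := by
      refine (hcont s₁ hs₁ab).tendsto.mono_left ?_
      rw [← nhdsWithin_Ico_eq_nhdsLT has₁]
      exact nhdsWithin_mono _ fun x hx => ⟨hx.1, hx.2.le.trans hs₁ab.2⟩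
    have h2 : Tendsto (fun s => e.chart (e.chart.symm (γ s))) (𝓝[<] s₁) (𝓝 (γ s₁)) := by
      refine h1.congr' ?_
      filter_upwards [hev] with s hs
      exact (e.chart.right_inv (hreg s hs).1).symm
    exact h2.mono_left (Ultrafilter.of_le _)
  have hU : ∀ s ∈ Ico a s₁, P.U (e.chart.symm (γ a)) ≤ P.U (e.chart.symm (γ s)) := fun s hs =>
    P.isTimeFunction_U.monotoneOn (fun X => P.continuousAt_U) hγ le_rfl
      (hs.2.le.trans hs₁ab.2) (fun s' hs' => hreg s' ⟨hs'.1, hs'.2.trans_lt hs.2⟩)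
      (left_mem_Icc.2 hs.1) (right_mem_Icc.2 hs.1) hs.1
  have hV : ∀ s ∈ Ico a s₁, P.V (e.chart.symm (γ a)) ≤ P.V (e.chart.symm (γ s)) := fun s hs =>
    P.isTimeFunction_V.monotoneOn (fun X => P.continuousAt_V) hγ le_rfl
      (hs.2.le.trans hs₁ab.2) (fun s' hs' => hreg s' ⟨hs'.1, hs'.2.trans_lt hs.2⟩)
      (left_mem_Icc.2 hs.1) (right_mem_Icc.2 hs.1) hs.1
  have hlt : ∀ s ∈ Ico a s₁, _ := fun s hs =>
    hcon s ⟨hs.1, hs.2.le.trans hs₁ab.2⟩ (hreg s hs)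
  -- If $U$ stayed below the claimed value, monotonicity of $V$ would give $r\ge$ `P.radius + 1`,
  -- and monotonicity of $U$ would bound $U$ from below. The exit point would then lie in the region
  -- or on future null infinity, but it is outside the region and in the interior.
  rcases P.mem_of_retarded_bounded (h𝒰ev _ fun s hs => P.le_norm_of_le (hreg s hs).2
      (by linarith [hV s hs, hlt s hs]))
    (h𝒰ev _ fun s hs => ⟨hU s hs, (hlt s hs).le⟩) hlim with h | h
  · exact hs₁r h
  · exact (C.mem_interior_iff.1 (hint hs₁ab)).1 h

/-- A timelike curve that leaves the far region towards the past attains an early advanced time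
there. -/
lemma exists_advanced_le {γ : ℝ → M} {a b : ℝ} (hγ : C.IsTimelikeCurve γ a b)
    (hint : MapsTo γ (Icc a b) ((𝓡∂ 4).interior M)) (hb : γ b ∈ P.region)
    (hex : ∃ s ∈ Icc a b, γ s ∉ P.region) :
    ∃ s ∈ Icc a b, γ s ∈ P.region ∧
      P.V (e.chart.symm (γ s)) ≤ P.U (e.chart.symm (γ b)) + 2 * tort μ P.A (P.radius + 1) := by
  by_contra! hcon
  have hcont : ContinuousOn γ (Icc a b) := hγ.2.1.continuousOn
  have hS : IsClosed (Icc a b ∩ γ ⁻¹' P.regionᶜ) :=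
    hcont.preimage_isClosed_of_isClosed isClosed_Icc P.isOpen_region.isClosed_compl
  have hScomp : IsCompact (Icc a b ∩ γ ⁻¹' P.regionᶜ) :=
    isCompact_Icc.of_isClosed_subset hS inter_subset_left
  have hSne : (Icc a b ∩ γ ⁻¹' P.regionᶜ).Nonempty := hex
  set s₁ := sSup (Icc a b ∩ γ ⁻¹' P.regionᶜ) with hs₁
  obtain ⟨hs₁ab, hs₁r⟩ : s₁ ∈ Icc a b ∩ γ ⁻¹' P.regionᶜ := hScomp.sSup_mem hSne
  have hbs₁ : s₁ < b := hs₁ab.2.lt_of_ne fun h => hs₁r (h.symm ▸ hb)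
  have hreg : ∀ s ∈ Ioc s₁ b, γ s ∈ P.region := by
    intro s hs
    by_contra h
    exact notMem_of_csSup_lt hs.1 hScomp.bddAbove
      ⟨⟨hs₁ab.1.trans hs.1.le, hs.2⟩, h⟩
  have hev : ∀ᶠ s in 𝓝[>] s₁, s ∈ Ioc s₁ b := Ioc_mem_nhdsGT hbs₁
  set 𝒰 : Ultrafilter (ℝ × E3) := (Ultrafilter.of (𝓝[>] s₁)).map (fun s => e.chart.symm (γ s))
    with h𝒰
  have h𝒰ev : ∀ p : ℝ × E3 → Prop, (∀ s ∈ Ioc s₁ b, p (e.chart.symm (γ s))) →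
      ∀ᶠ X in (𝒰 : Filter (ℝ × E3)), p X := by
    intro p hp
    have : ∀ᶠ s in 𝓝[>] s₁, p (e.chart.symm (γ s)) := hev.mono hp
    exact this.filter_mono (Ultrafilter.of_le _)
  have hlim : Tendsto e.chart 𝒰 (𝓝 (γ s₁)) := by
    have h1 : Tendsto γ (𝓝[>] s₁) (𝓝 (γ s₁)) := by
      refine (hcont s₁ hs₁ab).tendsto.mono_left ?_
      rw [← nhdsWithin_Ioc_eq_nhdsGT hbs₁]
      exact nhdsWithin_mono _ fun x hx => ⟨hs₁ab.1.trans hx.1.le, hx.2⟩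
    have h2 : Tendsto (fun s => e.chart (e.chart.symm (γ s))) (𝓝[>] s₁) (𝓝 (γ s₁)) := by
      refine h1.congr' ?_
      filter_upwards [hev] with s hs
      exact (e.chart.right_inv (hreg s hs).1).symm
    exact h2.mono_left (Ultrafilter.of_le _)
  have hU : ∀ s ∈ Ioc s₁ b, P.U (e.chart.symm (γ s)) ≤ P.U (e.chart.symm (γ b)) := fun s hs =>
    P.isTimeFunction_U.monotoneOn (fun X => P.continuousAt_U) hγ (hs₁ab.1.trans hs.1.le) le_rfl
      (fun s' hs' => hreg s' ⟨hs.1.trans_le hs'.1, hs'.2⟩)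
      (left_mem_Icc.2 hs.2) (right_mem_Icc.2 hs.2) hs.2
  have hV : ∀ s ∈ Ioc s₁ b, P.V (e.chart.symm (γ s)) ≤ P.V (e.chart.symm (γ b)) := fun s hs =>
    P.isTimeFunction_V.monotoneOn (fun X => P.continuousAt_V) hγ (hs₁ab.1.trans hs.1.le) le_rfl
      (fun s' hs' => hreg s' ⟨hs.1.trans_le hs'.1, hs'.2⟩)
      (left_mem_Icc.2 hs.2) (right_mem_Icc.2 hs.2) hs.2
  have hlt : ∀ s ∈ Ioc s₁ b, _ := fun s hs =>
    hcon s ⟨hs₁ab.1.trans hs.1.le, hs.2⟩ (hreg s hs)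
  rcases P.mem_of_advanced_bounded (h𝒰ev _ fun s hs => P.le_norm_of_le (hreg s hs).2
      (by linarith [hU s hs, hlt s hs]))
    (h𝒰ev _ fun s hs => ⟨(hlt s hs).le, hV s hs⟩) hlim with h | h
  · exact hs₁r h
  · exact (C.mem_interior_iff.1 (hint hs₁ab)).2 h

end FarRegion

end StationaryVacuumEnd

end Penrose

/-! ### The causality argument -/

namespace Penrose

variable {M : Type*} [TopologicalSpace M] [ChartedSpace (EuclideanHalfSpace 4) M]
  [IsManifold (𝓡∂ 4) 1 M] {C : ConformalCompletion M} {m : ℝ} {e : StationaryVacuumEnd C m}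

lemma Spacetime.IsTimelikeCurve.reflTransGen {S : Spacetime M} {γ : ℝ → M} {a b s s' : ℝ}
    (h : S.IsTimelikeCurve γ a b) (hs : a ≤ s) (hs' : s' ≤ b) (hss' : s ≤ s') :
    Relation.ReflTransGen S.TimelikeJoined (γ s) (γ s') := by
  rcases hss'.eq_or_lt with rfl | hlt
  · exact Relation.ReflTransGen.refl
  · exact Relation.ReflTransGen.single (h.timelikeJoined hs hs' hlt)

namespace StationaryVacuumEnd

namespace FarRegion

variable {μ : ℝ} (P : e.FarRegion μ)

lemma Φ_eq_U {w : E3} (hw : ‖w‖ = 1) {t r : ℝ} (hr : 0 < r) :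
    P.Φ w (t, r • w) = P.U (t, r • w) := by
  simp only [Φ, U, inner_smul_right, real_inner_self_eq_norm_sq, norm_smul, hw,
    Real.norm_of_nonneg hr.le]
  field_simp

lemma Φ_eq_V {w : E3} (hw : ‖w‖ = 1) {t r : ℝ} (hr : 0 < r) :
    P.Φ w (t, r • -w) = P.V (t, r • -w) := by
  simp only [Φ, V, inner_smul_right, inner_neg_right, real_inner_self_eq_norm_sq, norm_smul,
    norm_neg, hw, Real.norm_of_nonneg hr.le]
  field_simp
  ring

variable [T2Space M]

/-- The future of a point of the far region: either `Φ` has not decreased, or a late retarded time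
has been attained on the way. -/
lemma future_alternative {w : E3} (hw : ‖w‖ = 1) {X₁ : ℝ × E3} (hX₁ : P.radius < ‖X₁.2‖) {q : M}
    (h : Relation.ReflTransGen C.TimelikeJoined (e.chart X₁) q) (hq : q ∉ C.scriPlus) :
    (q ∈ P.region ∧ P.Φ w X₁ ≤ P.Φ w (e.chart.symm q) ∧ P.V X₁ ≤ P.V (e.chart.symm q)) ∨
      ∃ X : ℝ × E3, P.radius < ‖X.2‖ ∧ P.V X₁ - 2 * tort μ P.A (P.radius + 1) ≤ P.U X ∧
        Relation.ReflTransGen C.TimelikeJoined (e.chart X) q := by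
  induction h with
  | refl =>
    left
    rw [P.symm_chart hX₁.le]
    exact ⟨P.chart_mem_region hX₁, le_rfl, le_rfl⟩
  | @tail z q _ hzq ih =>
    rcases ih (ConformalCompletion.notMem_scriPlus_of_timelikeJoined hzq) with
      ⟨hz, hΦ, hV⟩ | ⟨X, hX, hU, hXz⟩
    · have hq' : q ∈ (𝓡∂ 4).interior M := C.mem_interior_iff.2
        ⟨hq, ConformalCompletion.notMem_scriMinus_of_timelikeJoined hzq⟩
      obtain ⟨γ, a, b, hγ, rfl, rfl⟩ := hzq
      have hab := hγ.1.le
      by_cases hex : ∃ s ∈ Icc a b, γ s ∉ P.region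
      · right
        -- The exit estimate refers to $V$ at the start of this piece; this is why the induction
        -- also carries the monotonicity of $V$.
        obtain ⟨s, hs, hsr, hU⟩ := P.exists_retarded_ge hγ (ConformalCompletion.mapsTo_interior hγ
          (P.region_subset_interior hz) hq') hz hex
        refine ⟨e.chart.symm (γ s), hsr.2, by linarith, ?_⟩
        rw [e.chart.right_inv hsr.1]
        exact hγ.reflTransGen hs.1 le_rfl hs.2
      · left
        push Not at hex
        have ha := left_mem_Icc.2 hab
        have hb := right_mem_Icc.2 hab
        exact ⟨hex b hb,
          hΦ.trans ((P.isTimeFunction_Φ hw).monotoneOn (fun X => P.continuousAt_Φ w) hγ le_rfl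
            le_rfl hex ha hb hab),
          hV.trans (P.isTimeFunction_V.monotoneOn (fun X => P.continuousAt_V) hγ le_rfl le_rfl hex
            ha hb hab)⟩
    · exact Or.inr ⟨X, hX, hU, hXz.tail hzq⟩

/-- The past of a point of the far region: either retarded time has not increased, or an early
advanced time has been attained on the way. -/
lemma past_alternative {X₂ : ℝ × E3} (hX₂ : P.radius < ‖X₂.2‖) {p : M}
    (h : Relation.ReflTransGen C.TimelikeJoined p (e.chart X₂)) (hp : p ∉ C.scriMinus) :
    (p ∈ P.region ∧ P.U (e.chart.symm p) ≤ P.U X₂) ∨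
      ∃ Y : ℝ × E3, P.radius < ‖Y.2‖ ∧ P.V Y ≤ P.U X₂ + 2 * tort μ P.A (P.radius + 1) ∧
        Relation.ReflTransGen C.TimelikeJoined p (e.chart Y) := by
  induction h using Relation.ReflTransGen.head_induction_on with
  | refl =>
    left
    rw [P.symm_chart hX₂.le]
    exact ⟨P.chart_mem_region hX₂, le_rfl⟩
  | @head p z hpz _ ih =>
    rcases ih (ConformalCompletion.notMem_scriMinus_of_timelikeJoined hpz) with
      ⟨hz, hU⟩ | ⟨Y, hY, hV, hzY⟩
    · have hp' : p ∈ (𝓡∂ 4).interior M := C.mem_interior_iff.2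
        ⟨ConformalCompletion.notMem_scriPlus_of_timelikeJoined hpz, hp⟩
      obtain ⟨γ, a, b, hγ, rfl, rfl⟩ := hpz
      have hab := hγ.1.le
      by_cases hex : ∃ s ∈ Icc a b, γ s ∉ P.region
      · right
        obtain ⟨s, hs, hsr, hV⟩ := P.exists_advanced_le hγ (ConformalCompletion.mapsTo_interior hγ
          hp' (P.region_subset_interior hz)) hz hex
        refine ⟨e.chart.symm (γ s), hsr.2, by linarith, ?_⟩
        rw [e.chart.right_inv hsr.1]
        exact hγ.reflTransGen le_rfl hs.2 hs.1
      · left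
        push Not at hex
        have ha := left_mem_Icc.2 hab
        have hb := right_mem_Icc.2 hab
        exact ⟨hex a ha, (P.isTimeFunction_U.monotoneOn (fun X => P.continuousAt_U) hγ le_rfl
          le_rfl hex ha hb hab).trans hU⟩
    · exact Or.inr ⟨Y, hY, hV, hzY.head hpz⟩

/-- Points in opposite directions are not joined by a timelike curve if the advanced time of the
first one is much larger than the retarded time of the second one. -/
lemma notMem_chronFuture_of_opposite {w : E3} (hw : ‖w‖ = 1) {t₁ t₂ r₁ r₂ : ℝ}
    (hr₁ : P.radius < r₁) (hr₂ : P.radius < r₂)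
    (h : P.U (t₂, r₂ • w) + (4 * tort μ P.A (P.radius + 1) + 24 * P.radius + 4) <
      P.V (t₁, r₁ • -w)) :
    e.chart (t₂, r₂ • w) ∉ C.chronFuture (e.chart (t₁, r₁ • -w)) := by
  intro hchron
  have h0 := P.radius_pos
  have hT := P.tort_nonneg (P.radius + 1) (by linarith)
  have hX₁ : P.radius < ‖((t₁, r₁ • -w) : ℝ × E3).2‖ := by
    rwa [norm_smul, norm_neg, hw, mul_one, Real.norm_of_nonneg (by linarith)]
  have hX₂ : P.radius < ‖((t₂, r₂ • w) : ℝ × E3).2‖ := by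
    rwa [norm_smul, hw, mul_one, Real.norm_of_nonneg (by linarith)]
  have hint : ∀ X : ℝ × E3, P.radius < ‖X.2‖ → e.chart X ∉ C.scriPlus ∧ e.chart X ∉ C.scriMinus :=
    fun X hX => C.mem_interior_iff.1 (e.chart_mem_interior (P.mem_endDomain hX.le))
  rcases P.future_alternative hw hX₁ hchron.to_reflTransGen (hint _ hX₂).1 with
    ⟨-, hΦ, -⟩ | ⟨X, hX, hU, hXX₂⟩
  -- No excursion: monotonicity of $\Phi$ gives $V(X_1)\le U(X_2)$, against `h`.
  · rw [P.symm_chart hX₂.le, P.Φ_eq_U hw (by linarith), P.Φ_eq_V hw (by linarith)] at hΦ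
    linarith
  rcases P.past_alternative hX₂ hXX₂ (hint _ hX).2 with ⟨-, hU'⟩ | ⟨Y, hY, hV, hXY⟩
  · rw [P.symm_chart hX.le] at hU'
    linarith
  -- The two terms $2f$ at exit and return, together with `24 * P.radius + 4` for the path from `Y`
  -- to `X`, add up to the constant in `h`. As `X` precedes or equals `Y` along the curve, this
  -- closes a timelike loop.
  · have hYX : e.chart X ∈ C.chronFuture (e.chart Y) :=
      P.mem_chronFuture_of_le hX.le hY.le (by linarith)
    exact C.chronological _ (Relation.TransGen.trans_left hYX hXY)

/-- Antipodal points of null infinity are not joined by a timelike curve if they are close enough to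
spatial infinity. -/
lemma notMem_chronFuture_scri {w : E3} (hw : ‖w‖ = 1) {u v : ℝ}
    (h : u + (4 * tort μ P.A (P.radius + 1) + 24 * P.radius + 6 + 2 * |P.c|) < v) :
    e.compactChart (scriPlusPoint u w) ∉
      C.chronFuture (e.compactChart (scriMinusPoint v (-w))) := by
  intro hchron
  have hw' : ‖-w‖ = 1 := by rw [norm_neg, hw]
  have hnorm : ∀ {n : E3}, ‖n‖ = 1 → ∀ᶠ r : ℝ in atTop, ‖r • n‖ = r := by
    intro n hn
    filter_upwards [eventually_ge_atTop 0] with r hr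
    rw [norm_smul, hn, mul_one, Real.norm_of_nonneg hr]
  have hrad : ∀ {n : E3}, ‖n‖ = 1 → Tendsto (fun r : ℝ => ‖r • n‖) atTop atTop := fun hn =>
    tendsto_id.congr' ((hnorm hn).mono fun r hr => hr.symm)
  have hdir : ∀ {n : E3}, ‖n‖ = 1 →
      Tendsto (fun r : ℝ => ‖r • n‖⁻¹ • r • n) atTop (𝓝 n) := by
    intro n hn
    refine tendsto_const_nhds.congr' ?_
    filter_upwards [hnorm hn, eventually_gt_atTop 0] with r hr h0
    rw [hr, inv_smul_smul₀ h0.ne']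
  have lim₂ := P.tendsto_scriPlus (X := fun r : ℝ => (u + e.rstar r, r • w)) (u := u) hw
    (hrad hw) (tendsto_const_nhds.congr' ((hnorm hw).mono fun r hr => by simp [hr])) (hdir hw)
  have lim₁ := P.tendsto_scriMinus (X := fun r : ℝ => (v - e.rstar r, r • -w)) (v := v) hw'
    (hrad hw') (tendsto_const_nhds.congr' ((hnorm hw').mono fun r hr => by
      dsimp only
      rw [hr, sub_add_cancel])) (hdir hw')
  -- Openness is available in each argument separately, so the endpoint is moved into the interior
  -- first, and then the initial point, relative to the new endpoint.
  obtain ⟨r₂, h₂, hr₂, hn₂⟩ := ((lim₂.eventually (Spacetime.eventually_mem_chronFuture hchron)).and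
    ((eventually_gt_atTop P.radius).and (hnorm hw))).exists
  obtain ⟨r₁, h₁, hr₁, hn₁⟩ := ((lim₁.eventually (Spacetime.eventually_chronFuture_mem h₂)).and
    ((eventually_gt_atTop P.radius).and (hnorm hw'))).exists
  refine P.notMem_chronFuture_of_opposite hw hr₁ hr₂ ?_ h₁
  -- Passing from $r_*$ to `tort` costs at most $1+|c|$ at each end; hence the `6 = 4 + 2` and `2 *
  -- |P.c|` in `h`.
  have c₁ := abs_le.1 (P.rstar_close r₁ hr₁.le)
  have c₂ := abs_le.1 (P.rstar_close r₂ hr₂.le)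
  simp only [U, V, hn₁, hn₂]
  linarith [le_abs_self P.c, c₁.1, c₂.2, c₁.2, c₂.1]

end FarRegion

end StationaryVacuumEnd

end Penrose

/-! ### Pairs of points close to spatial infinity -/

theorem claim1 {M : Type*} [TopologicalSpace M] [T2Space M]
    [ChartedSpace (EuclideanHalfSpace 4) M] [IsManifold (𝓡∂ 4) 1 M]
    (C : Penrose.ConformalCompletion M) (m : ℝ) (e : Penrose.StationaryVacuumEnd C m)
    (hm : m < 0) :
    ¬ C.PenroseProperty ∧
      ∀ ε : ℝ, 0 < ε → ∃ p ∈ C.scriMinus ∩ e.nearSpatialInfinity ε,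
        ∃ q ∈ C.scriPlus ∩ e.nearSpatialInfinity ε, q ∉ C.chronFuture p := by
  have key : ∀ ε : ℝ, 0 < ε → ∃ p ∈ C.scriMinus ∩ e.nearSpatialInfinity ε,
      ∃ q ∈ C.scriPlus ∩ e.nearSpatialInfinity ε, q ∉ C.chronFuture p := by
    intro ε hε
    obtain ⟨P⟩ := e.exists_farRegion hm
    set w : Penrose.E3 := EuclideanSpace.single 0 1
    have hw : ‖w‖ = 1 := by simp [w]
    have hw' : ‖-w‖ = 1 := by rw [norm_neg, hw]
    have hlim : Tendsto Real.arctan atTop (𝓝 (Real.pi / 2)) :=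
      tendsto_nhds_of_tendsto_nhdsWithin Real.tendsto_arctan_atTop
    -- With $u=-N$ and $v=N$ the required gap is $2N$, so the constant of `notMem_chronFuture_scri`
    -- is halved. Both points have $\chi=\pi/2+\arctan N$ and $|T|=\pi/2-\arctan N<\varepsilon$.
    obtain ⟨N, hN, hNε⟩ := ((eventually_gt_atTop
      (2 * Penrose.tort (-m) P.A (P.radius + 1) + 12 * P.radius + 3 + |P.c|)).and
      (hlim.eventually (lt_mem_nhds (sub_lt_self (Real.pi / 2) hε)))).exists
    have hNπ := Real.arctan_lt_pi_div_two N
    have hq := Penrose.scriPlusPoint_mem (-N) hw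
    have hp := Penrose.scriMinusPoint_mem N hw'
    refine ⟨_, ⟨e.compactChart_scriMinus _ hp, _, ⟨Or.inr hp, ?_, ?_⟩, rfl⟩, _,
      ⟨e.compactChart_scriPlus _ hq, _, ⟨Or.inl (Or.inr hq), ?_, ?_⟩, rfl⟩,
      P.notMem_chronFuture_scri hw (by linarith)⟩
    · simp only [Penrose.scriMinusPoint]
      linarith
    · simp only [Penrose.scriMinusPoint]
      rw [abs_lt]
      constructor <;> linarith
    · simp only [Penrose.scriPlusPoint, Real.arctan_neg]
      linarith
    · simp only [Penrose.scriPlusPoint, Real.arctan_neg]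
      rw [abs_lt]
      constructor <;> linarith
  refine ⟨fun h => ?_, key⟩
  obtain ⟨p, hp, q, hq, hpq⟩ := key 1 one_pos
  exact hpq (h p hp.1 q hq.1)
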